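/- **Setting.** Let $n\ge 1$; for $i=1,\dots,n$ let $\mathscr X_i$ be a measurable space with a $\sigma$-finite measure $\mu_i$. Let $X=(X_1,\dots,X_n)$ have independent coordinates $X_i\in\mathscr X_i$ with arbitrary laws $P_i^\star$, so that $X$ has law $\mathbf P^\star=\bigotimes_i P_i^\star$. Let $\mathcal Q$ be a set of product densities $\mathbf q=(q_1,\dots,q_n)$, where $q_i:\mathscr X_i\to[0,\infty)$ is a probability density with respect to $\mu_i$. The model is $\mathscr P=\{\mathbf Q=\bigotimes_i q_i\cdot\mu_i:\ \mathbf q\in\mathcal Q\}$; it need not contain $\mathbf P^\star$, and $\mathbf P^\star$ need not be dominated by $\bigotimes_i\mu_i$. To avoid measurability problems, assume that there is a countable $\mathcal S\subset\mathcal Q$ such that every $\mathbf q\in\mathcal Q$ is the limit of a sequence $(\mathbf q^{(k)})$ in $\mathcal S$ with, for all $i$ and $x\in\mathscr X_i$, $q_i^{(k)}(x)\to q_i(x)$, and $q^{(k)}_i(x)=0$ for all large $k$ if $q_i(x)=0$ (this holds if $\mathcal Q$ is countable). For product laws put $H^2(\mathbf P,\mathbf Q)=\sum_{i=1}^n h^2(P_i,Q_i)$,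 where $h^2(P,Q)=\frac12\int(\sqrt{dP/d\nu}-\sqrt{dQ/d\nu})^2d\nu$ for any $\nu$ dominating $P$ and $Q$. Let $\psi:[0,\infty]\to\mathbb R$ be continuous and strictly increasing with $\psi(1)=0$, $\psi(1/x)=-\psi(x)$ and $\psi(0)=-1$. With the conventions $0/0=1$ and $a/0=\infty$ for $a>0$, put $$\mathbf T(x,\mathbf q,\mathbf q')=\sum_{i=1}^n\psi\Big(\sqrt{q_i'(x_i)/q_i(x_i)}\Big).$$ A $\rho$-estimator is any $\widehat{\mathbf P}(X)=\bigotimes_i\widehat p_i\cdot\mu_i$ where, for every observation, $\widehat{\mathbf p}=\widehat{\mathbf p}(X)$ is an element of $\mathcal Q$ at which $\mathbf q\mapsto\sup_{\mathbf q'\in\mathcal Q}\mathbf T(X,\mathbf q,\mathbf q')$ attains its minimum over $\mathcal Q$. Let $a_0\ge1\ge a_1>0$ and $a_2\ge 0$ with $a_2^2\ge\max(1,6a_1)$. We say that $\psi$ satisfies the moment conditions with constants $(a_0,a_1,a_2)$ on $\mathcal Q$ if, for all $\mathbf q,\mathbf q'\in\mathcal Q$, all $i$ and every probability $R$ on $\mathscr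 X_i$, with $Q_i=q_i\cdot\mu_i$ and $Q'_i=q'_i\cdot\mu_i$, $$\int\psi\big(\sqrt{q_i'/q_i}\big)dR\le a_0h^2(R,Q_i)-a_1h^2(R,Q_i'),\qquad \int\psi^2\big(\sqrt{q_i'/q_i}\big)dR\le a_2^2\big[h^2(R,Q_i)+h^2(R,Q_i')\big].$$ For $\overline{\mathbf P}\in\mathscr P$ with density $\overline{\mathbf p}\in\mathcal Q$ and $y>0$, let $w(y)$ be the expectation under $\mathbf P^\star$ of $$\sup\big\{|\mathbf T(X,\overline{\mathbf p},\mathbf q)-\mathbb E_{\mathbf P^\star}\mathbf T(X,\overline{\mathbf p},\mathbf q)|:\ \mathbf q\in\mathcal Q,\ H^2(\mathbf P^\star,\overline{\mathbf P})+H^2(\mathbf P^\star,\mathbf Q)<y^2\big\}$$ (with $\sup\emptyset=0$), and define the local dimension $$D_n^{\mathscr P}(\mathbf P^\star,\overline{\mathbf P})=\max\Big\{1,\ \frac{a_1^2}{16a_2^2}\,\sup\big\{y^2:\ y>0,\ w(y)>a_1y^2/8\big\}\Big\}.$$ **Theorem.** (i) Let either $\psi(x)=\psi_1(x)=\frac{x-1}{x+1}$,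 with $a_1=3/8$ and $a_2^2=3\sqrt2$ in the definition of $D_n^{\mathscr P}$, or $\psi(x)=\psi_2(x)=\frac{x-1}{\sqrt{x^2+1}}$, with $a_1=0.083$ and $a_2^2=3+2\sqrt2$. Then, with the universal constant $C=26350$, for all $n$, $\mathscr X_i$, $\mu_i$, $\mathcal Q$ and $\mathbf P^\star$ as above: - $1\le D_n^{\mathscr P}(\mathbf P^\star,\overline{\mathbf P})\le n$ for every $\overline{\mathbf P}\in\mathscr P$; - for every $\rho$-estimator $\widehat{\mathbf P}$, every $\overline{\mathbf P}\in\mathscr P$ and every $\xi\ge0$, $$\mathbb P_{\mathbf P^\star}\Big[H^2(\mathbf P^\star,\widehat{\mathbf P})\le C\big[H^2(\mathbf P^\star,\overline{\mathbf P})+D_n^{\mathscr P}(\mathbf P^\star,\overline{\mathbf P})+\xi\big]\Big]\ge1-e^{-\xi}$$ (in the sense that the complementary event has outer probability at most $e^{-\xi}$); - for every $\rho$-estimator $\widehat{\mathbf P}$ whose loss $H^2(\mathbf P^\star,\widehat{\mathbf P})$ is measurable, this loss is integrable, and $\mathbb E_{\mathbf P^\star}[H^2(\mathbf P^\star,\widehat{\mathbf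 P})]$ is at most $$C\inf_{\overline{\mathbf P}\in\mathscr P}\{H^2(\mathbf P^\star,\overline{\mathbf P})+D_n^{\mathscr P}(\mathbf P^\star,\overline{\mathbf P})+1\}\quad\text{and at most}\quad C\inf_{\overline{\mathbf P}\in\mathscr P}\{H^2(\mathbf P^\star,\overline{\mathbf P})+2D_n^{\mathscr P}(\mathbf P^\star,\overline{\mathbf P})\}.$$ (ii) For all $a_0,a_1,a_2$ as above there is a constant $C\ge1$ depending only on $(a_0,a_1,a_2)$ such that the same three conclusions hold for all $n$, $\mathscr X_i$, $\mu_i$, $\mathcal Q$ and $\mathbf P^\star$ as above and every function $\psi$ as above that satisfies the moment conditions with constants $(a_0,a_1,a_2)$ on $\mathcal Q$. -/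

import Mathlib

open MeasureTheory Filter Topology Set
open scoped ENNReal NNReal

namespace RhoEst

noncomputable section

/-! ### Hellinger losses -/

/-- The squared Hellinger distance `h²(P, Q) = ½ ∫ (√(dP/dν) - √(dQ/dν))² dν` between two finite
measures, computed with the dominating measure `ν = P + Q` (the value does not depend on `ν`). -/
def hellingerSq {X : Type*} [MeasurableSpace X] (P Q : Measure X) : ℝ :=
  (1 / 2) * ∫ x, (√((P.rnDeriv (P + Q) x).toReal) - √((Q.rnDeriv (P + Q) x).toReal)) ^ 2 ∂(P + Q)

variable {n : ℕ} {X : Fin n → Type*} [∀ i, MeasurableSpace (X i)]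

/-- The squared distance `H²(P, Q) = ∑ᵢ h²(Pᵢ, Qᵢ)` between the product laws with marginals `Pᵢ`
and `Qᵢ`. -/
def prodHellingerSq (P Q : ∀ i, Measure (X i)) : ℝ :=
  ∑ i, hellingerSq (P i) (Q i)

/-! ### Density models -/

/-- `q = (q₁, …, qₙ)` is a family of probability densities `qᵢ` with respect to `μᵢ`; it stands for
the product density `q₁ ⊗ ⋯ ⊗ qₙ`. -/
structure IsDensity (μ : ∀ i, Measure (X i)) (q : ∀ i, X i → ℝ≥0) : Prop where
  measurable : ∀ i, Measurable (q i)
  lintegral_eq_one : ∀ i, ∫⁻ x, (q i x : ℝ≥0∞) ∂(μ i) = 1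

/-- The marginals `qᵢ · μᵢ` of the product law with density `q`. -/
def law (μ : ∀ i, Measure (X i)) (q : ∀ i, X i → ℝ≥0) : ∀ i, Measure (X i) :=
  fun i => (μ i).withDensity fun x => (q i x : ℝ≥0∞)

/-- Measurability convention on the set of densities: some countable subset `S` is such that every
`q ∈ 𝒬` is the limit, at every point, of a sequence of elements of `S` whose terms vanish
eventually at each point where `q` vanishes. Any countable `𝒬` has this property. -/
def IsSeparableModel (𝒬 : Set (∀ i, X i → ℝ≥0)) : Prop :=
  ∃ S ⊆ 𝒬, S.Countable ∧ ∀ q ∈ 𝒬, ∃ u : ℕ → ∀ i, X i → ℝ≥0, (∀ k, u k ∈ S) ∧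
    ∀ i x, Tendsto (fun k => u k i x) atTop (𝓝 (q i x)) ∧
      (q i x = 0 → ∀ᶠ k in atTop, u k i x = 0)

/-! ### The function `ψ` -/

/-- The ratio `a / b ∈ [0, ∞]`, with the conventions `0 / 0 = 1` and `a / 0 = ∞` for `a > 0`. -/
def ratio (a b : ℝ≥0) : ℝ≥0∞ :=
  if a = 0 ∧ b = 0 then 1 else (a : ℝ≥0∞) / (b : ℝ≥0∞)

/-- `ψ(√(q' / q))` as a function of the two density values. -/
def psiRatio (ψ : ℝ≥0∞ → ℝ) (q q' : ℝ≥0) : ℝ :=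
  ψ (ratio q' q ^ (1 / 2 : ℝ))

/-- The standing conditions on `ψ : [0, ∞] → ℝ`: it is continuous and strictly increasing,
`ψ(1) = 0`, `ψ(1/x) = -ψ(x)`, and it is normalised by `ψ(0) = -1` (hence `ψ(∞) = 1`). -/
structure IsRhoFunction (ψ : ℝ≥0∞ → ℝ) : Prop where
  continuous : Continuous ψ
  strictMono : StrictMono ψ
  map_one : ψ 1 = 0
  map_inv : ∀ x, ψ x⁻¹ = -ψ x
  map_zero : ψ 0 = -1

/-- The first and second moment conditions linking `ψ` to the Hellinger distance, with constants
`a₀, a₁, a₂`, for the densities of `𝒬` and under arbitrary probabilities `R`. -/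
structure MomentConditions (ψ : ℝ≥0∞ → ℝ) (a₀ a₁ a₂ : ℝ) (μ : ∀ i, Measure (X i))
    (𝒬 : Set (∀ i, X i → ℝ≥0)) : Prop where
  expectation_le : ∀ q ∈ 𝒬, ∀ q' ∈ 𝒬, ∀ i, ∀ R : Measure (X i), IsProbabilityMeasure R →
    ∫ x, psiRatio ψ (q i x) (q' i x) ∂(R)
      ≤ a₀ * hellingerSq R (law μ q i) - a₁ * hellingerSq R (law μ q' i)
  second_moment_le : ∀ q ∈ 𝒬, ∀ q' ∈ 𝒬, ∀ i, ∀ R : Measure (X i), IsProbabilityMeasure R →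
    ∫ x, psiRatio ψ (q i x) (q' i x) ^ 2 ∂(R)
      ≤ a₂ ^ 2 * (hellingerSq R (law μ q i) + hellingerSq R (law μ q' i))

/-- `ψ₁(x) = (x - 1) / (x + 1)`, with `ψ₁(∞) = 1`. -/
def psi₁ (x : ℝ≥0∞) : ℝ :=
  if x = ∞ then 1 else (x.toReal - 1) / (x.toReal + 1)

/-- `ψ₂(x) = (x - 1) / √(x² + 1)`, with `ψ₂(∞) = 1`. -/
def psi₂ (x : ℝ≥0∞) : ℝ :=
  if x = ∞ then 1 else (x.toReal - 1) / √(x.toReal ^ 2 + 1)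

/-! ### The statistic and the estimators -/

/-- `T(x, q, q') = ∑ᵢ ψ(√(q'ᵢ(xᵢ) / qᵢ(xᵢ)))`. -/
def T (ψ : ℝ≥0∞ → ℝ) (x : ∀ i, X i) (q q' : ∀ i, X i → ℝ≥0) : ℝ :=
  ∑ i, psiRatio ψ (q i (x i)) (q' i (x i))

/-- `p̂` is (the density of) a `ρ`-estimator: for every observation `x`, `p̂ x` is an element of `𝒬`
that minimises `q ↦ sup_{q' ∈ 𝒬} T(x, q, q')` over `𝒬`. -/
def IsRhoEstimator (ψ : ℝ≥0∞ → ℝ) (𝒬 : Set (∀ i, X i → ℝ≥0))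
    (phat : (∀ i, X i) → ∀ i, X i → ℝ≥0) : Prop :=
  ∀ x, phat x ∈ 𝒬 ∧ ∀ q ∈ 𝒬, (⨆ q' : 𝒬, T ψ x (phat x) q') ≤ ⨆ q' : 𝒬, T ψ x q q'

/-! ### The local dimension -/

/-- The fluctuation `Z(x, q, q') = T(x, q, q') - E_P[T(·, q, q')]`, under the product law of `P`. -/
def Z (ψ : ℝ≥0∞ → ℝ) (P : ∀ i, Measure (X i)) (x : ∀ i, X i) (q q' : ∀ i, X i → ℝ≥0) : ℝ :=
  T ψ x q q' - ∫ x', T ψ x' q q' ∂(Measure.pi P)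

/-- The part `{q ∈ 𝒬 : H²(P, P̄) + H²(P, Q) < y²}` of the model, where `P̄` and `Q` are the laws
with densities `pbar` and `q`. -/
def localModel (μ : ∀ i, Measure (X i)) (𝒬 : Set (∀ i, X i → ℝ≥0)) (P : ∀ i, Measure (X i))
    (pbar : ∀ i, X i → ℝ≥0) (y : ℝ) : Set (∀ i, X i → ℝ≥0) :=
  {q ∈ 𝒬 | prodHellingerSq P (law μ pbar) + prodHellingerSq P (law μ q) < y ^ 2}

/-- The expected supremum of `|Z(·, p̄, q)|` over the local model of radius `y` (zero if the local
model is empty). -/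
def fluctuation (ψ : ℝ≥0∞ → ℝ) (μ : ∀ i, Measure (X i)) (𝒬 : Set (∀ i, X i → ℝ≥0))
    (P : ∀ i, Measure (X i)) (pbar : ∀ i, X i → ℝ≥0) (y : ℝ) : ℝ :=
  ∫ x, (⨆ q : localModel μ 𝒬 P pbar y, |Z ψ P x pbar q|) ∂(Measure.pi P)

/-- The local dimension
`D(P, P̄) = max {1, β² sup {y² : y > 0, fluctuation(y) > a₁ y² / 8}}`, where `β = a₁ / (4 a₂)`
(and the supremum of the empty set is `0`). -/
def localDim (ψ : ℝ≥0∞ → ℝ) (a₁ a₂ : ℝ) (μ : ∀ i, Measure (X i)) (𝒬 : Set (∀ i, X i → ℝ≥0))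
    (P : ∀ i, Measure (X i)) (pbar : ∀ i, X i → ℝ≥0) : ℝ :=
  max 1 ((a₁ / (4 * a₂)) ^ 2 *
    sSup {z : ℝ | ∃ y : ℝ, 0 < y ∧ z = y ^ 2 ∧ a₁ * y ^ 2 / 8 < fluctuation ψ μ 𝒬 P pbar y})

/-! ### The performance bounds -/

/-- The performance of the `ρ`-estimators on the model `𝒬` under the true product law with
marginals `P`, with constant `C`. -/
structure RhoBounds (C : ℝ) (ψ : ℝ≥0∞ → ℝ) (a₁ a₂ : ℝ) (μ : ∀ i, Measure (X i))
    (𝒬 : Set (∀ i, X i → ℝ≥0)) (P : ∀ i, Measure (X i)) : Prop where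
  /-- The local dimension lies in `[1, n]`. -/
  dim_mem : ∀ pbar ∈ 𝒬, localDim ψ a₁ a₂ μ 𝒬 P pbar ∈ Icc (1 : ℝ) n
  /-- The deviation bound; the (outer) probability of the complementary event is at most `e^{-ξ}`. -/
  deviation : ∀ phat, IsRhoEstimator ψ 𝒬 phat → ∀ pbar ∈ 𝒬, ∀ ξ : ℝ, 0 ≤ ξ →
    Measure.pi P {x | ¬ (prodHellingerSq P (law μ (phat x))
        ≤ C * (prodHellingerSq P (law μ pbar) + localDim ψ a₁ a₂ μ 𝒬 P pbar + ξ))}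
      ≤ ENNReal.ofReal (Real.exp (-ξ))
  /-- The integrated bound, for estimators whose loss is measurable. -/
  risk : ∀ phat, IsRhoEstimator ψ 𝒬 phat →
    AEMeasurable (fun x => prodHellingerSq P (law μ (phat x))) (Measure.pi P) →
    Integrable (fun x => prodHellingerSq P (law μ (phat x))) (Measure.pi P) ∧
    ∫ x, prodHellingerSq P (law μ (phat x)) ∂(Measure.pi P)
      ≤ C * (⨅ pbar : 𝒬, (prodHellingerSq P (law μ pbar) + localDim ψ a₁ a₂ μ 𝒬 P pbar + 1)) ∧
    ∫ x, prodHellingerSq P (law μ (phat x)) ∂(Measure.pi P)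
      ≤ C * (⨅ pbar : 𝒬, (prodHellingerSq P (law μ pbar) + 2 * localDim ψ a₁ a₂ μ 𝒬 P pbar))

end

end RhoEst

/-!
The estimator is compared with a fixed `p̄ ∈ 𝒬`.  Since `ψ` is odd under inversion, `T(x, p̂, p̄)` is
`-T(x, p̄, p̂)`, and minimality of `p̂` gives `-T(x, p̄, p̂) ≤ sup_q T(x, p̄, q)`.  The first moment
condition bounds `E T(·, p̄, q)` by `a₀ H²(P, P̄) - A H²(P, Q)`.  So it suffices to bound the
fluctuations `Z(x, p̄, q)` from above, uniformly in `q`, by a small multiple of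
`A (H²(P, P̄) + H²(P, Q))` plus a multiple of `D + ξ` (`IsRegularModel.loss_le`).

This is done by peeling `𝒬` into the local models of squared radii `2 ^ j * m * (D + ξ) / β²`
(`IsRegularModel.measure_peeling_le`).  At such radii the definition of the local dimension bounds
the expected fluctuation, and the second moment condition bounds the variances by `a₂² y²`.  What is
needed is a Bernstein-type deviation inequality for the supremum of an empirical process of
independent, not identically distributed variables in terms of its mean and of the largest variance
(`IsCenteredFamily.measure_procMax_ge_le`).  It is proved by the entropy method: the entropy of
`exp (l F)`, where `F` is the maximum of finitely many sums, is subadditive over the coordinates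
(`entropy_le_sum`).  In one coordinate (`IsCenteredFamily.entropy_coord_le`) `exp (l F)` is compared
with the mixture of the exponentials of the sums, with weights the conditional probabilities, given
the other coordinates, that a sum attains the maximum.  Herbst's argument then integrates the
differential inequality (`cgf_le_of_entropy_le`).  Separability passes from finite index sets to
local models; here Fatou's lemma shows that the Hellinger distance is upper semicontinuous along
pointwise convergent densities (`eventually_hellingerSq_lt`).

For `psi₁` and `psi₂`, pointwise inequalities between square roots of densities, integrated against
a dominating measure, give the first moment condition with `a₀ = 48` and `A = 3 / 8`, together with
the second one with the constants `3√2` and `3 + 2√2`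
(`momentConditions_psi₁`, `momentConditions_psi₂`).  For `psi₂` this `A` is much larger than the
constant `0.083` in the definition of the local dimension.  The deviation argument keeps the two
constants apart, and the room between them gives the numerical constant `26350`.
-/

open MeasureTheory Filter Topology Set
open scoped ENNReal NNReal

namespace RhoEst

noncomputable section

set_option linter.unusedSectionVars false

/-! ### Bounded measurable functions and averages over one coordinate -/

/-- Bounded measurable real functions; they are integrable for every finite measure. -/
structure BddMeasurable {Ω : Type*} [MeasurableSpace Ω] (f : Ω → ℝ) : Prop where
  measurable : Measurable f
  bdd : ∃ C, ∀ x, |f x| ≤ C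

/-- Measurable real functions with values in a compact subinterval of `(0, ∞)`. -/
structure PosBddMeasurable {Ω : Type*} [MeasurableSpace Ω] (f : Ω → ℝ) : Prop where
  measurable : Measurable f
  bdd : ∃ c C : ℝ, 0 < c ∧ ∀ x, c ≤ f x ∧ f x ≤ C

section BddMeasurable

variable {Ω : Type*} [MeasurableSpace Ω] {f g : Ω → ℝ}

lemma BddMeasurable.integrable (hf : BddMeasurable f) (m : Measure Ω) [IsFiniteMeasure m] :
    Integrable f m := by
  obtain ⟨C, hC⟩ := hf.bdd
  exact Integrable.of_bound hf.measurable.aestronglyMeasurable C (ae_of_all _ hC)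

lemma BddMeasurable.const (c : ℝ) : BddMeasurable (fun _ : Ω => c) :=
  ⟨measurable_const, |c|, fun _ => le_rfl⟩

lemma BddMeasurable.add (hf : BddMeasurable f) (hg : BddMeasurable g) :
    BddMeasurable (fun x => f x + g x) := by
  obtain ⟨C, hC⟩ := hf.bdd
  obtain ⟨D, hD⟩ := hg.bdd
  exact ⟨hf.measurable.add hg.measurable, C + D,
    fun x => (abs_add_le _ _).trans (add_le_add (hC x) (hD x))⟩

lemma BddMeasurable.neg (hf : BddMeasurable f) : BddMeasurable (fun x => -f x) := by
  obtain ⟨C, hC⟩ := hf.bdd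
  exact ⟨hf.measurable.neg, C, fun x => by rw [abs_neg]; exact hC x⟩

lemma BddMeasurable.sub (hf : BddMeasurable f) (hg : BddMeasurable g) :
    BddMeasurable (fun x => f x - g x) := by
  simpa only [sub_eq_add_neg] using hf.add hg.neg

lemma BddMeasurable.mul (hf : BddMeasurable f) (hg : BddMeasurable g) :
    BddMeasurable (fun x => f x * g x) := by
  obtain ⟨C, hC⟩ := hf.bdd
  obtain ⟨D, hD⟩ := hg.bdd
  refine ⟨hf.measurable.mul hg.measurable, C * D, fun x => ?_⟩
  rw [abs_mul]
  exact mul_le_mul (hC x) (hD x) (abs_nonneg _) ((abs_nonneg _).trans (hC x))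

lemma BddMeasurable.const_mul (hf : BddMeasurable f) (c : ℝ) :
    BddMeasurable (fun x => c * f x) := (BddMeasurable.const c).mul hf

lemma BddMeasurable.sum {κ : Type*} (s : Finset κ) {f : κ → Ω → ℝ}
    (hf : ∀ i ∈ s, BddMeasurable (f i)) : BddMeasurable (fun x => ∑ i ∈ s, f i x) := by
  classical
  induction s using Finset.induction_on with
  | empty => simpa using BddMeasurable.const (Ω := Ω) 0
  | insert a s ha ih =>
    simp only [Finset.sum_insert ha]
    exact (hf a (Finset.mem_insert_self a s)).add
      (ih fun i hi => hf i (Finset.mem_insert_of_mem hi))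

lemma BddMeasurable.comp {Ω' : Type*} [MeasurableSpace Ω'] (hf : BddMeasurable f) {φ : Ω' → Ω}
    (hφ : Measurable φ) : BddMeasurable (fun x => f (φ x)) := by
  obtain ⟨C, hC⟩ := hf.bdd
  exact ⟨hf.measurable.comp hφ, C, fun x => hC _⟩

lemma BddMeasurable.posBdd_exp (hf : BddMeasurable f) :
    PosBddMeasurable (fun x => Real.exp (f x)) := by
  obtain ⟨C, hC⟩ := hf.bdd
  refine ⟨hf.measurable.exp, Real.exp (-C), Real.exp C, Real.exp_pos _, fun x => ⟨?_, ?_⟩⟩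
  · exact Real.exp_le_exp.2 (abs_le.1 (hC x)).1
  · exact Real.exp_le_exp.2 (abs_le.1 (hC x)).2

lemma PosBddMeasurable.bddMeasurable (hf : PosBddMeasurable f) : BddMeasurable f := by
  obtain ⟨c, C, hc, h⟩ := hf.bdd
  exact ⟨hf.measurable, C, fun x => by rw [abs_of_pos (hc.trans_le (h x).1)]; exact (h x).2⟩

lemma PosBddMeasurable.pos (hf : PosBddMeasurable f) (x : Ω) : 0 < f x := by
  obtain ⟨c, C, hc, h⟩ := hf.bdd
  exact hc.trans_le (h x).1

lemma PosBddMeasurable.log (hf : PosBddMeasurable f) :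
    BddMeasurable (fun x => Real.log (f x)) := by
  obtain ⟨c, C, hc, h⟩ := hf.bdd
  refine ⟨hf.measurable.log, |Real.log c| + |Real.log C|, fun x => ?_⟩
  have h1 := Real.log_le_log hc (h x).1
  have h2 := Real.log_le_log (hc.trans_le (h x).1) (h x).2
  rw [abs_le]
  constructor
  · linarith [neg_abs_le (Real.log c), abs_nonneg (Real.log C)]
  · linarith [le_abs_self (Real.log C), abs_nonneg (Real.log c)]

lemma PosBddMeasurable.inv (hf : PosBddMeasurable f) : BddMeasurable (fun x => (f x)⁻¹) := by
  obtain ⟨c, C, hc, h⟩ := hf.bdd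
  refine ⟨hf.measurable.inv, c⁻¹, fun x => ?_⟩
  rw [abs_of_pos (inv_pos.2 (hc.trans_le (h x).1))]
  exact inv_anti₀ hc (h x).1

end BddMeasurable

section Coordinates

variable {ι : Type*} [Fintype ι] [DecidableEq ι] {X : ι → Type*} [∀ i, MeasurableSpace (X i)]
  (P : ∀ i, Measure (X i)) [∀ i, IsProbabilityMeasure (P i)]

/-- The average of `f` over the `k`-th coordinate, the other coordinates being fixed. -/
def avgCoord (k : ι) (f : (∀ i, X i) → ℝ) (x : ∀ i, X i) : ℝ :=
  ∫ y, f (Function.update x k y) ∂(P k)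

/-- `f` does not depend on the `k`-th coordinate. -/
def IndepOfCoord (k : ι) (f : (∀ i, X i) → ℝ) : Prop :=
  ∀ x y, f (Function.update x k y) = f x

/-- Resampling one coordinate of a product measure preserves it. -/
lemma measurePreserving_update (k : ι) :
    MeasurePreserving (fun p : (∀ i, X i) × X k => Function.update p.1 k p.2)
      ((Measure.pi P).prod (P k)) (Measure.pi P) := by
  refine ⟨measurable_update', ?_⟩
  refine (Measure.pi_eq fun s hs => ?_).symm
  rw [Measure.map_apply measurable_update' (MeasurableSet.univ_pi hs)]
  have : (fun p : (∀ i, X i) × X k => Function.update p.1 k p.2) ⁻¹' (univ.pi s)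
      = (univ.pi (Function.update s k univ)) ×ˢ (s k) := by
    ext ⟨x, y⟩
    simp only [mem_preimage, Set.mem_pi, mem_univ, forall_true_left, mem_prod]
    constructor
    · intro h
      refine ⟨fun i => ?_, by simpa using h k⟩
      by_cases hi : i = k
      · subst hi; simp
      · simpa [hi] using h i
    · rintro ⟨h1, h2⟩ i
      by_cases hi : i = k
      · subst hi; simpa using h2
      · simpa [hi] using h1 i
  rw [this, Measure.prod_prod, Measure.pi_pi]
  rw [← Finset.prod_erase_mul _ _ (Finset.mem_univ k),
    ← Finset.prod_erase_mul Finset.univ (fun i => P i (s i)) (Finset.mem_univ k)]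
  simp only [Function.update_self, measure_univ, mul_one]
  congr 1
  refine Finset.prod_congr rfl fun i hi => ?_
  rw [Function.update_of_ne (Finset.ne_of_mem_erase hi)]

variable {P} {f g : (∀ i, X i) → ℝ} {k : ι}

lemma BddMeasurable.update (hf : BddMeasurable f) (x : ∀ i, X i) (k : ι) :
    BddMeasurable (fun y => f (Function.update x k y)) :=
  hf.comp (measurable_update x)

lemma BddMeasurable.avgCoord (hf : BddMeasurable f) (k : ι) :
    BddMeasurable (avgCoord P k f) := by
  obtain ⟨C, hC⟩ := hf.bdd
  refine ⟨?_, C, fun x => ?_⟩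
  · have h : Measurable (fun p : (∀ i, X i) × X k => f (Function.update p.1 k p.2)) :=
      hf.measurable.comp measurable_update'
    exact (h.stronglyMeasurable.integral_prod_right' (ν := P k)).measurable
  · have := norm_integral_le_of_norm_le_const (μ := P k)
      (f := fun y => f (Function.update x k y)) (ae_of_all _ fun y => hC _)
    simpa [RhoEst.avgCoord] using this

lemma PosBddMeasurable.avgCoord (hf : PosBddMeasurable f) (k : ι) :
    PosBddMeasurable (avgCoord P k f) := by
  obtain ⟨c, C, hc, h⟩ := hf.bdd
  refine ⟨(hf.bddMeasurable.avgCoord k).measurable, c, C, hc, fun x => ⟨?_, ?_⟩⟩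
  · have := integral_mono (μ := P k) (integrable_const c)
      ((hf.bddMeasurable.update x k).integrable _) fun y => (h (Function.update x k y)).1
    simpa [RhoEst.avgCoord] using this
  · have := integral_mono (μ := P k) ((hf.bddMeasurable.update x k).integrable _)
      (integrable_const C) fun y => (h (Function.update x k y)).2
    simpa [RhoEst.avgCoord] using this

lemma integral_avgCoord (hf : BddMeasurable f) (k : ι) :
    ∫ x, avgCoord P k f x ∂(Measure.pi P) = ∫ x, f x ∂(Measure.pi P) := by
  have hm := measurePreserving_update P k
  have h1 : ∫ x, f x ∂(Measure.pi P)
      = ∫ p, f (Function.update p.1 k p.2) ∂((Measure.pi P).prod (P k)) := by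
    rw [← integral_map (f := f) hm.measurable.aemeasurable
      hf.measurable.aestronglyMeasurable, hm.map_eq]
  rw [h1, integral_prod _ ((hf.comp hm.measurable).integrable _)]
  rfl

lemma indepOfCoord_avgCoord (k : ι) (f : (∀ i, X i) → ℝ) :
    IndepOfCoord k (avgCoord P k f) := by
  intro x y
  simp [avgCoord]

lemma IndepOfCoord.avgCoord_of (hf : IndepOfCoord k f) (j : ι) :
    IndepOfCoord k (avgCoord P j f) := by
  intro x y
  by_cases hj : j = k
  · subst hj; exact indepOfCoord_avgCoord j f x y
  · unfold avgCoord
    refine integral_congr_ae (ae_of_all _ fun z => ?_)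
    show f (Function.update (Function.update x k y) j z) = f (Function.update x j z)
    rw [Function.update_comm (Ne.symm hj), hf]

/-- A factor that does not depend on the `k`-th coordinate can be moved across the average. -/
lemma avgCoord_mul_of_indep (hf : IndepOfCoord k f) (g : (∀ i, X i) → ℝ) (x : ∀ i, X i) :
    avgCoord P k (fun x => f x * g x) x = f x * avgCoord P k g x := by
  unfold avgCoord
  simp only [hf x, integral_const_mul]

lemma integral_mul_avgCoord (hf : BddMeasurable f) (hg : BddMeasurable g)
    (hi : IndepOfCoord k f) :
    ∫ x, f x * avgCoord P k g x ∂(Measure.pi P) = ∫ x, f x * g x ∂(Measure.pi P) := by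
  rw [← integral_avgCoord (hf.mul hg) k]
  simp only [avgCoord_mul_of_indep hi]

lemma eq_of_indepOfCoord (h : ∀ k, IndepOfCoord k f) (x y : ∀ i, X i) : f x = f y := by
  classical
  have key : ∀ s : Finset ι, f (s.piecewise y x) = f x := by
    intro s
    induction s using Finset.induction_on with
    | empty => simp
    | insert a s ha ih => rw [Finset.piecewise_insert, h a, ih]
  simpa using (key Finset.univ).symm

/-! ### Tensorization of entropy -/

/-- Gibbs' variational principle in one coordinate: among the conditional densities
`g / avgCoord P k g`, the one of `f` itself maximises the integral of the logarithm against `f`. -/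
lemma integral_mul_log_avgCoord_le (hf : PosBddMeasurable f) (hg : PosBddMeasurable g) (k : ι) :
    ∫ x, f x * (Real.log (g x) - Real.log (avgCoord P k g x)) ∂(Measure.pi P)
      ≤ ∫ x, f x * (Real.log (f x) - Real.log (avgCoord P k f x)) ∂(Measure.pi P) := by
  have hf' := hf.avgCoord (P := P) k
  have hg' := hg.avgCoord (P := P) k
  have hw : BddMeasurable fun x => avgCoord P k f x * (avgCoord P k g x)⁻¹ :=
    hf'.bddMeasurable.mul hg'.inv
  have hwi : IndepOfCoord k fun x => avgCoord P k f x * (avgCoord P k g x)⁻¹ := by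
    intro x y
    simp only [indepOfCoord_avgCoord k f x y, indepOfCoord_avgCoord k g x y]
  have e : ∫ x, (avgCoord P k f x * (avgCoord P k g x)⁻¹) * g x ∂(Measure.pi P)
      = ∫ x, f x ∂(Measure.pi P) := by
    rw [← integral_mul_avgCoord hw hg.bddMeasurable hwi, ← integral_avgCoord hf.bddMeasurable k]
    refine integral_congr_ae (ae_of_all _ fun x => ?_)
    have := (hg'.pos x).ne'
    simp only
    field_simp
  have b1 : BddMeasurable fun x => f x * (Real.log (g x) - Real.log (avgCoord P k g x)) :=
    hf.bddMeasurable.mul (hg.log.sub hg'.log)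
  have b2 : BddMeasurable fun x => f x * (Real.log (f x) - Real.log (avgCoord P k f x)) :=
    hf.bddMeasurable.mul (hf.log.sub hf'.log)
  have b3 : BddMeasurable fun x => (avgCoord P k f x * (avgCoord P k g x)⁻¹) * g x :=
    hw.mul hg.bddMeasurable
  have key := integral_mono (b1.integrable (Measure.pi P))
    ((b2.add (b3.sub hf.bddMeasurable)).integrable (Measure.pi P)) fun x => by
      have p1 := hf.pos x
      have p2 := hg.pos x
      have p3 := hf'.pos x
      have p4 := hg'.pos x
      have hpos : 0 < avgCoord P k f x * (avgCoord P k g x)⁻¹ * g x / f x := by positivity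
      have hl := Real.log_le_sub_one_of_pos hpos
      rw [Real.log_div (by positivity) p1.ne', Real.log_mul (by positivity) p2.ne',
        Real.log_mul p3.ne' (by positivity), Real.log_inv] at hl
      have hl2 := mul_le_mul_of_nonneg_left hl p1.le
      have e2 : f x * (avgCoord P k f x * (avgCoord P k g x)⁻¹ * g x / f x - 1)
          = avgCoord P k f x * (avgCoord P k g x)⁻¹ * g x - f x := by
        field_simp
      rw [e2] at hl2
      simp only
      linarith
  rw [integral_add (b2.integrable _) ((b3.sub hf.bddMeasurable).integrable _),
    integral_sub (b3.integrable _) (hf.bddMeasurable.integrable _), e, sub_self, add_zero] at key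
  exact key

/-- Averaging successively over the coordinates in a list. -/
def avgList (P : ∀ i, Measure (X i)) (l : List ι) (f : (∀ i, X i) → ℝ) : (∀ i, X i) → ℝ :=
  l.foldr (fun k g => avgCoord P k g) f

lemma PosBddMeasurable.avgList (hf : PosBddMeasurable f) (l : List ι) :
    PosBddMeasurable (avgList P l f) := by
  induction l with
  | nil => exact hf
  | cons k l ih => exact ih.avgCoord k

lemma integral_avgList (hf : PosBddMeasurable f) (l : List ι) :
    ∫ x, avgList P l f x ∂(Measure.pi P) = ∫ x, f x ∂(Measure.pi P) := by
  induction l with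
  | nil => rfl
  | cons k l ih =>
    rw [← ih]
    exact integral_avgCoord (hf.avgList l).bddMeasurable k

lemma indepOfCoord_avgList (f : (∀ i, X i) → ℝ) (l : List ι) :
    ∀ k ∈ l, IndepOfCoord k (avgList P l f) := by
  induction l with
  | nil => simp
  | cons j l ih =>
    intro k hk
    rcases List.mem_cons.1 hk with rfl | hk
    · exact indepOfCoord_avgCoord k _
    · exact (ih k hk).avgCoord_of j

lemma integral_log_avgList_le (hf : PosBddMeasurable f) (l : List ι) :
    ∫ x, f x * Real.log (f x) ∂(Measure.pi P)
        - ∫ x, f x * Real.log (avgList P l f x) ∂(Measure.pi P)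
      ≤ (l.map fun k => ∫ x, f x * (Real.log (f x) - Real.log (avgCoord P k f x))
          ∂(Measure.pi P)).sum := by
  induction l with
  | nil => simp [avgList]
  | cons k l ih =>
    have h := integral_mul_log_avgCoord_le (P := P) hf (hf.avgList (P := P) l) k
    have hg := hf.avgList (P := P) l
    have hg' := hg.avgCoord (P := P) k
    simp only [List.map_cons, List.sum_cons]
    have e : ∫ x, f x * (Real.log (avgList P l f x)
          - Real.log (avgCoord P k (avgList P l f) x)) ∂(Measure.pi P)
        = ∫ x, f x * Real.log (avgList P l f x) ∂(Measure.pi P)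
          - ∫ x, f x * Real.log (avgList P (k :: l) f x) ∂(Measure.pi P) := by
      simp only [mul_sub]
      exact integral_sub ((hf.bddMeasurable.mul hg.log).integrable _)
        ((hf.bddMeasurable.mul hg'.log).integrable _)
    linarith

/-- Subadditivity of entropy under a product measure. -/
theorem entropy_le_sum (hf : PosBddMeasurable f) :
    ∫ x, f x * Real.log (f x) ∂(Measure.pi P)
        - (∫ x, f x ∂(Measure.pi P)) * Real.log (∫ x, f x ∂(Measure.pi P))
      ≤ ∑ k, ∫ x, f x * (Real.log (f x) - Real.log (avgCoord P k f x)) ∂(Measure.pi P) := by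
  have h := integral_log_avgList_le (P := P) hf (Finset.univ : Finset ι).toList
  rw [Finset.sum_map_toList] at h
  have hc : ∀ x, avgList P (Finset.univ : Finset ι).toList f x = ∫ x, f x ∂(Measure.pi P) := by
    intro x
    rw [← integral_avgList (P := P) hf (Finset.univ : Finset ι).toList]
    have : ∀ y, avgList P (Finset.univ : Finset ι).toList f y
        = avgList P (Finset.univ : Finset ι).toList f x := fun y =>
      eq_of_indepOfCoord (fun k => indepOfCoord_avgList f _ k (by simp)) y x
    simp [this]
  simp only [hc, integral_mul_const] at h
  exact h

end Coordinates

/-! ### Concentration of the maximum of finitely many sums of independent variables -/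

section Concentration

variable {ι : Type*} [Fintype ι] [DecidableEq ι] {X : ι → Type*} [∀ i, MeasurableSpace (X i)]
  {P : ∀ i, Measure (X i)} [∀ i, IsProbabilityMeasure (P i)]
  {κ : Type*} [Fintype κ] [Nonempty κ] {U : κ → ∀ i, X i → ℝ}

/-- For every index `s`, the variables `U s i (x i)` are centered and bounded by `2` in absolute
value. -/
structure IsCenteredFamily (P : ∀ i, Measure (X i)) (U : κ → ∀ i, X i → ℝ) : Prop where
  measurable : ∀ s i, Measurable (U s i)
  bound : ∀ s i y, |U s i y| ≤ 2
  integral_eq_zero : ∀ s i, ∫ y, U s i y ∂(P i) = 0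

/-- The sum of the variables with index `s`. -/
def procSum (U : κ → ∀ i, X i → ℝ) (s : κ) (x : ∀ i, X i) : ℝ := ∑ i, U s i (x i)

/-- The maximum of the sums over the finite index set. -/
def procMax (U : κ → ∀ i, X i → ℝ) (x : ∀ i, X i) : ℝ :=
  Finset.univ.sup' Finset.univ_nonempty fun s => procSum U s x

/-- The uniform probability weights on the set of indices at which the maximum is attained. -/
def argmaxWeight (U : κ → ∀ i, X i → ℝ) (s : κ) (x : ∀ i, X i) : ℝ :=
  (if procSum U s x = procMax U x then 1 else 0)
    / ∑ t, if procSum U t x = procMax U x then (1 : ℝ) else 0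

lemma IsCenteredFamily.bddMeasurable (hU : IsCenteredFamily P U) (s : κ) (i : ι) :
    BddMeasurable (U s i) := ⟨hU.measurable s i, 2, hU.bound s i⟩

lemma IsCenteredFamily.bddMeasurable_coord (hU : IsCenteredFamily P U) (s : κ) (i : ι) :
    BddMeasurable (fun x : ∀ i, X i => U s i (x i)) :=
  (hU.bddMeasurable s i).comp (measurable_pi_apply i)

lemma IsCenteredFamily.bddMeasurable_procSum (hU : IsCenteredFamily P U) (s : κ) :
    BddMeasurable (procSum U s) :=
  BddMeasurable.sum _ fun i _ => hU.bddMeasurable_coord s i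

lemma procSum_le_procMax (U : κ → ∀ i, X i → ℝ) (s : κ) (x : ∀ i, X i) :
    procSum U s x ≤ procMax U x :=
  Finset.le_sup' (fun s => procSum U s x) (Finset.mem_univ s)

lemma exists_procSum_eq_procMax (U : κ → ∀ i, X i → ℝ) (x : ∀ i, X i) :
    ∃ s, procSum U s x = procMax U x := by
  obtain ⟨s, -, hs⟩ := Finset.exists_mem_eq_sup' Finset.univ_nonempty fun s => procSum U s x
  exact ⟨s, hs.symm⟩

lemma IsCenteredFamily.bddMeasurable_procMax (hU : IsCenteredFamily P U) :
    BddMeasurable (procMax U) := by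
  constructor
  · have := Finset.measurable_sup' (s := Finset.univ) Finset.univ_nonempty
      fun s _ => (hU.bddMeasurable_procSum s).measurable
    convert this using 1
    ext x
    simp [procMax, Finset.sup'_apply]
  · choose C hC using fun s => (hU.bddMeasurable_procSum s).bdd
    refine ⟨∑ s, |C s|, fun x => ?_⟩
    obtain ⟨s, hs⟩ := exists_procSum_eq_procMax U x
    rw [← hs]
    exact ((hC s x).trans (le_abs_self _)).trans
      (Finset.single_le_sum (f := fun s => |C s|) (fun i _ => abs_nonneg _) (Finset.mem_univ s))

lemma argmaxWeight_nonneg (U : κ → ∀ i, X i → ℝ) (s : κ) (x : ∀ i, X i) :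
    0 ≤ argmaxWeight U s x :=
  div_nonneg (by split_ifs <;> norm_num)
    (Finset.sum_nonneg fun t _ => by split_ifs <;> norm_num)

lemma sum_argmaxWeight (U : κ → ∀ i, X i → ℝ) (x : ∀ i, X i) :
    ∑ s, argmaxWeight U s x = 1 := by
  unfold argmaxWeight
  rw [← Finset.sum_div]
  refine div_self (ne_of_gt ?_)
  obtain ⟨s, hs⟩ := exists_procSum_eq_procMax U x
  refine Finset.sum_pos' (fun t _ => by split_ifs <;> norm_num) ⟨s, Finset.mem_univ s, ?_⟩
  simp [hs]

lemma argmaxWeight_mul (U : κ → ∀ i, X i → ℝ) (s : κ) (x : ∀ i, X i) (φ : ℝ → ℝ) :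
    argmaxWeight U s x * φ (procSum U s x) = argmaxWeight U s x * φ (procMax U x) := by
  by_cases h : procSum U s x = procMax U x
  · rw [h]
  · simp [argmaxWeight, h]

lemma IsCenteredFamily.bddMeasurable_argmaxWeight (hU : IsCenteredFamily P U) (s : κ) :
    BddMeasurable (argmaxWeight U s) := by
  have hm : ∀ t, Measurable fun x => if procSum U t x = procMax U x then (1 : ℝ) else 0 :=
    fun t => Measurable.ite (measurableSet_eq_fun (hU.bddMeasurable_procSum t).measurable
      hU.bddMeasurable_procMax.measurable) measurable_const measurable_const
  refine ⟨(hm s).div (Finset.measurable_fun_sum _ fun t _ => hm t), 1, fun x => ?_⟩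
  rw [abs_of_nonneg (argmaxWeight_nonneg U s x), ← sum_argmaxWeight U x]
  exact Finset.single_le_sum (f := fun s => argmaxWeight U s x)
    (fun t _ => argmaxWeight_nonneg U t x) (Finset.mem_univ s)

lemma procSum_update (U : κ → ∀ i, X i → ℝ) (s : κ) (x : ∀ i, X i) (k : ι) (y : X k) :
    procSum U s (Function.update x k y) = procSum U s x - U s k (x k) + U s k y := by
  unfold procSum
  rw [← Finset.sum_erase_add _ _ (Finset.mem_univ k),
    ← Finset.sum_erase_add Finset.univ (fun i => U s i (x i)) (Finset.mem_univ k)]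
  have : ∑ i ∈ Finset.univ.erase k, U s i (Function.update x k y i)
      = ∑ i ∈ Finset.univ.erase k, U s i (x i) :=
    Finset.sum_congr rfl fun i hi => by rw [Function.update_of_ne (Finset.ne_of_mem_erase hi)]
  rw [this, Function.update_self]
  ring

lemma IsCenteredFamily.procMax_le_update (hU : IsCenteredFamily P U) (x : ∀ i, X i) (k : ι)
    (y : X k) : procMax U x ≤ procMax U (Function.update x k y) + 4 := by
  refine Finset.sup'_le _ _ fun s _ => ?_
  have h1 := procSum_le_procMax U s (Function.update x k y)
  rw [procSum_update] at h1
  linarith [(abs_le.1 (hU.bound s k y)).1, (abs_le.1 (hU.bound s k (x k))).2]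

lemma integral_mul_coord {r : (∀ i, X i) → ℝ} (hr : BddMeasurable r) {k : ι}
    (hi : IndepOfCoord k r) {φ : X k → ℝ} (hφ : BddMeasurable φ) :
    ∫ x, r x * φ (x k) ∂(Measure.pi P)
      = (∫ x, r x ∂(Measure.pi P)) * ∫ y, φ y ∂(P k) := by
  rw [← integral_mul_avgCoord hr (hφ.comp (measurable_pi_apply k)) hi, ← integral_mul_const]
  simp [avgCoord]

lemma mul_exp_sub_one_le {l u : ℝ} (hl : 0 ≤ l) (hu : |u| ≤ 2) :
    u * (Real.exp (l * u) - 1) ≤ l * Real.exp (2 * l) * u ^ 2 := by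
  have hu' := abs_le.1 hu
  rcases le_total 0 u with h | h
  · have h1 := Real.add_one_le_exp (-(l * u))
    have h2 : Real.exp (l * u) - 1 ≤ l * u * Real.exp (l * u) := by
      have e : Real.exp (l * u) * Real.exp (-(l * u)) = 1 := by rw [← Real.exp_add]; simp
      nlinarith [Real.exp_pos (l * u)]
    have h3 : Real.exp (l * u) ≤ Real.exp (2 * l) := Real.exp_le_exp.2 (by nlinarith)
    calc u * (Real.exp (l * u) - 1) ≤ u * (l * u * Real.exp (l * u)) := by gcongr
      _ ≤ u * (l * u * Real.exp (2 * l)) := by gcongr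
      _ = _ := by ring
  · have h1 := Real.add_one_le_exp (l * u)
    have h3 : 1 ≤ Real.exp (2 * l) := Real.one_le_exp (by linarith)
    calc u * (Real.exp (l * u) - 1) = (-u) * (1 - Real.exp (l * u)) := by ring
      _ ≤ (-u) * (-(l * u)) := by
        apply mul_le_mul_of_nonneg_left _ (by linarith)
        linarith
      _ = l * 1 * u ^ 2 := by ring
      _ ≤ _ := by gcongr

lemma IsCenteredFamily.one_le_integral_exp (hU : IsCenteredFamily P U) (s : κ) (k : ι) (l : ℝ) :
    1 ≤ ∫ y, Real.exp (l * U s k y) ∂(P k) := by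
  have hb := hU.bddMeasurable s k
  have h := integral_mono (((hb.const_mul l).add (.const 1)).integrable (P k))
    ((hb.const_mul l).posBdd_exp.bddMeasurable.integrable (P k))
    fun y => Real.add_one_le_exp (l * U s k y)
  rw [integral_add ((hb.const_mul l).integrable _) (integrable_const _), integral_const_mul,
    hU.integral_eq_zero] at h
  simpa using h

lemma IsCenteredFamily.integral_mul_exp_le (hU : IsCenteredFamily P U) (s : κ) (k : ι) {l : ℝ}
    (hl : 0 ≤ l) : ∫ y, U s k y * Real.exp (l * U s k y) ∂(P k)
      ≤ l * Real.exp (2 * l) * ∫ y, U s k y ^ 2 ∂(P k) := by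
  have hb := hU.bddMeasurable s k
  have he := (hb.const_mul l).posBdd_exp.bddMeasurable
  have h2 : BddMeasurable fun y => U s k y ^ 2 := by simpa only [sq] using hb.mul hb
  have h := integral_mono ((hb.mul (he.sub (.const 1))).integrable (P k))
    ((h2.const_mul (l * Real.exp (2 * l))).integrable (P k))
    fun y => mul_exp_sub_one_le hl (hU.bound s k y)
  simp only [mul_sub, mul_one] at h
  rw [integral_sub ((hb.mul he).integrable _) (hb.integrable _), hU.integral_eq_zero, sub_zero,
    integral_const_mul] at h
  exact h

/-- The contribution of one coordinate to the entropy of `exp (l * procMax U)`.  The maximum is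
compared with the mixture of the sums `procSum U s` with weights `avgCoord P k (argmaxWeight U s)`:
these do not depend on the `k`-th coordinate, so that this coordinate enters the mixture only
through a centered variable with fixed index. -/
theorem IsCenteredFamily.entropy_coord_le (hU : IsCenteredFamily P U) (k : ι) {l : ℝ}
    (hl : 0 ≤ l) :
    ∫ x, Real.exp (l * procMax U x) * (Real.log (Real.exp (l * procMax U x))
        - Real.log (avgCoord P k (fun x => Real.exp (l * procMax U x)) x)) ∂(Measure.pi P)
      ≤ l ^ 2 * Real.exp (4 * l) * ∑ s, (∫ y, U s k y ^ 2 ∂(P k))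
          * ∫ x, argmaxWeight U s x * Real.exp (l * procMax U x) ∂(Measure.pi P)
        + 4 * l ^ 2 * ∑ s, ∫ x, argmaxWeight U s x * Real.exp (l * procMax U x) * U s k (x k)
          ∂(Measure.pi P) := by
  set f : (∀ i, X i) → ℝ := fun x => Real.exp (l * procMax U x) with hf_def
  set fb := avgCoord P k f with hfb_def
  set L : (∀ i, X i) → ℝ := fun x => Real.log (f x) - Real.log (fb x) with hL_def
  set w := argmaxWeight U with hw_def
  set r : κ → (∀ i, X i) → ℝ := fun s x =>
    avgCoord P k (w s) x * Real.exp (l * (procSum U s x - U s k (x k))) with hr_def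
  have hf : PosBddMeasurable f := (hU.bddMeasurable_procMax.const_mul l).posBdd_exp
  have hfb : PosBddMeasurable fb := hf.avgCoord k
  have hL : BddMeasurable L := hf.log.sub hfb.log
  have hw : ∀ s, BddMeasurable (w s) := fun s => hU.bddMeasurable_argmaxWeight s
  have hc : ∀ s, BddMeasurable fun x : ∀ i, X i => U s k (x k) :=
    fun s => hU.bddMeasurable_coord s k
  have hE : ∀ s, PosBddMeasurable
      fun x => Real.exp (l * (procSum U s x - U s k (x k))) := fun s =>
    (((hU.bddMeasurable_procSum s).sub (hc s)).const_mul l).posBdd_exp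
  have hEi : ∀ s, IndepOfCoord k
      fun x => Real.exp (l * (procSum U s x - U s k (x k))) := by
    intro s x y
    simp only [procSum_update, Function.update_self]
    ring_nf
  have hr : ∀ s, BddMeasurable (r s) := fun s => ((hw s).avgCoord k).mul (hE s).bddMeasurable
  have hri : ∀ s, IndepOfCoord k (r s) := by
    intro s x y
    have h1 := hEi s x y
    simp only at h1
    simp only [hr_def, indepOfCoord_avgCoord k (w s) x y, h1]
  have hwavg : ∀ s x, 0 ≤ avgCoord P k (w s) x :=
    fun s x => integral_nonneg fun y => argmaxWeight_nonneg U s _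
  have hr0 : ∀ s x, 0 ≤ r s x := fun s x => mul_nonneg (hwavg s x) (Real.exp_pos _).le
  have hexpb : ∀ s, PosBddMeasurable fun y => Real.exp (l * U s k y) :=
    fun s => ((hU.bddMeasurable s k).const_mul l).posBdd_exp
  have ha : ∀ s, BddMeasurable fun x : ∀ i, X i => Real.exp (l * U s k (x k)) :=
    fun s => (hexpb s).bddMeasurable.comp (measurable_pi_apply k)
  -- the conditional log-density is bounded above by the oscillation in the `k`-th coordinate
  have hL4 : ∀ x, L x ≤ 4 * l := by
    intro x
    have h1 : f x * Real.exp (-(4 * l)) ≤ fb x := by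
      have h2 := integral_mono (μ := P k) (integrable_const (f x * Real.exp (-(4 * l))))
        ((hf.bddMeasurable.update x k).integrable _) fun y => by
          simp only [hf_def, ← Real.exp_add]
          apply Real.exp_le_exp.2
          nlinarith [hU.procMax_le_update x k y]
      simp only [integral_const, probReal_univ, one_smul] at h2
      exact h2
    have h3 := Real.log_le_log (by have := hf.pos x; positivity) h1
    rw [Real.log_mul (hf.pos x).ne' (Real.exp_pos _).ne',
      Real.log_exp (-(4 * l))] at h3
    simp only [hL_def]
    linarith
  -- the mean of the weights of the mixture
  have hrint : ∀ s, ∫ x, r s x ∂(Measure.pi P)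
      = ∫ x, w s x * f x * Real.exp (-(l * U s k (x k))) ∂(Measure.pi P) := by
    intro s
    have h1 := integral_mul_avgCoord (P := P) (hE s).bddMeasurable (hw s) (hEi s)
    simp only [hr_def]
    rw [integral_congr_ae (ae_of_all _ fun x => mul_comm (avgCoord P k (w s) x) _), h1]
    refine integral_congr_ae (ae_of_all _ fun x => ?_)
    have h2 := argmaxWeight_mul U s x fun z => Real.exp (l * z)
    simp only [hf_def, hw_def, ← h2, mul_assoc, ← Real.exp_add]
    rw [mul_comm]
    ring_nf
  have hwf : ∀ s, BddMeasurable fun x => w s x * f x := fun s => (hw s).mul hf.bddMeasurable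
  have hneg : ∀ s, BddMeasurable fun x : ∀ i, X i => Real.exp (-(l * U s k (x k))) :=
    fun s => ((hc s).const_mul l).neg.posBdd_exp.bddMeasurable
  have hrint_le : ∀ s, ∫ x, r s x ∂(Measure.pi P)
      ≤ Real.exp (2 * l) * ∫ x, w s x * f x ∂(Measure.pi P) := by
    intro s
    rw [hrint, ← integral_const_mul]
    refine integral_mono (((hwf s).mul (hneg s)).integrable _)
      (((hwf s).const_mul _).integrable _) fun x => ?_
    rw [mul_comm (Real.exp (2 * l))]
    refine mul_le_mul_of_nonneg_left (Real.exp_le_exp.2 ?_)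
      (mul_nonneg (argmaxWeight_nonneg U s x) (hf.pos x).le)
    nlinarith [(abs_le.1 (hU.bound s k (x k))).1]
  have hrint_ge : ∀ s, ∫ x, w s x * f x ∂(Measure.pi P)
      - l * ∫ x, w s x * f x * U s k (x k) ∂(Measure.pi P) ≤ ∫ x, r s x ∂(Measure.pi P) := by
    intro s
    rw [hrint, ← integral_const_mul, ← integral_sub ((hwf s).integrable _)
      ((((hwf s).mul (hc s)).const_mul l).integrable _)]
    refine integral_mono (((hwf s).sub (((hwf s).mul (hc s)).const_mul l)).integrable _)
      (((hwf s).mul (hneg s)).integrable _) fun x => ?_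
    have h1 := Real.add_one_le_exp (-(l * U s k (x k)))
    have h2 := mul_le_mul_of_nonneg_left h1
      (mul_nonneg (argmaxWeight_nonneg U s x) (hf.pos x).le)
    simp only [hw_def] at h2 ⊢
    linarith
  have hra : ∀ s, ∫ x, r s x * Real.exp (l * U s k (x k)) ∂(Measure.pi P)
      = (∫ x, r s x ∂(Measure.pi P)) * ∫ y, Real.exp (l * U s k y) ∂(P k) :=
    fun s => integral_mul_coord (hr s) (hri s) (hexpb s).bddMeasurable
  have hrnn : ∀ s, 0 ≤ ∫ x, r s x ∂(Measure.pi P) := fun s => integral_nonneg (hr0 s)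
  -- each component of the mixture, by the variational formula for the entropy
  have comp : ∀ s, ∫ x, r s x * Real.exp (l * U s k (x k)) * L x ∂(Measure.pi P)
      ≤ l ^ 2 * Real.exp (4 * l) * ((∫ y, U s k y ^ 2 ∂(P k))
        * ∫ x, w s x * f x ∂(Measure.pi P)) := by
    intro s
    set A := ∫ y, Real.exp (l * U s k y) ∂(P k) with hA_def
    have hA : 1 ≤ A := hU.one_le_integral_exp s k l
    have hrf : BddMeasurable fun x => r s x * (fb x)⁻¹ := (hr s).mul hfb.inv
    have hrfi : IndepOfCoord k fun x => r s x * (fb x)⁻¹ := by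
      intro x y
      simp only [hri s x y, hfb_def, indepOfCoord_avgCoord k f x y]
    have e1 : ∫ x, r s x * (fb x)⁻¹ * f x ∂(Measure.pi P) = ∫ x, r s x ∂(Measure.pi P) := by
      rw [← integral_mul_avgCoord hrf hf.bddMeasurable hrfi]
      refine integral_congr_ae (ae_of_all _ fun x => ?_)
      have := (hfb.pos x).ne'
      simp only [← hfb_def]
      field_simp
    have b0 : BddMeasurable fun y => U s k y * Real.exp (l * U s k y) :=
      (hU.bddMeasurable s k).mul (hexpb s).bddMeasurable
    have b1 : BddMeasurable fun x => r s x * (U s k (x k) * Real.exp (l * U s k (x k))) :=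
      (hr s).mul ((hc s).mul (ha s))
    have b2 : BddMeasurable fun x => r s x * (fb x)⁻¹ * f x := hrf.mul hf.bddMeasurable
    have b3 : BddMeasurable fun x => r s x * Real.exp (l * U s k (x k)) := (hr s).mul (ha s)
    have h := integral_mono ((b3.mul hL).integrable (Measure.pi P))
      (((b1.const_mul l).add ((b2.const_mul A).sub b3)).integrable (Measure.pi P)) fun x => by
        have p1 := hf.pos x
        have p2 := hfb.pos x
        have p3 := Real.exp_pos (l * U s k (x k))
        have hA0 : 0 < A := by linarith
        have hl1 := Real.log_le_sub_one_of_pos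
          (show 0 < f x * (fb x)⁻¹ * A / Real.exp (l * U s k (x k)) by positivity)
        rw [Real.log_div (by positivity) p3.ne', Real.log_mul (by positivity) hA0.ne',
          Real.log_mul p1.ne' (by positivity), Real.log_inv,
          Real.log_exp (l * U s k (x k))] at hl1
        have hlA := Real.log_nonneg hA
        have hl2 : L x ≤ l * U s k (x k)
            + (f x * (fb x)⁻¹ * A / Real.exp (l * U s k (x k)) - 1) := by
          simp only [hL_def]; linarith
        have hl3 := mul_le_mul_of_nonneg_left hl2 (mul_nonneg (hr0 s x) p3.le)
        refine hl3.trans (le_of_eq ?_)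
        field_simp
    rw [integral_add ((b1.const_mul l).integrable _) (((b2.const_mul A).sub b3).integrable _),
      integral_sub ((b2.const_mul A).integrable _) (b3.integrable _), integral_const_mul,
      integral_const_mul, e1, hra, integral_mul_coord (hr s) (hri s) b0] at h
    have h2 := hU.integral_mul_exp_le s k hl
    have h3 := hrint_le s
    have hσ : 0 ≤ ∫ y, U s k y ^ 2 ∂(P k) := integral_nonneg fun y => sq_nonneg _
    calc _ ≤ l * ((∫ x, r s x ∂(Measure.pi P))
              * ∫ y, U s k y * Real.exp (l * U s k y) ∂(P k)) := by
            refine h.trans (le_of_eq ?_); ring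
      _ ≤ l * ((∫ x, r s x ∂(Measure.pi P))
              * (l * Real.exp (2 * l) * ∫ y, U s k y ^ 2 ∂(P k))) := by
            have := hrnn s
            gcongr
      _ ≤ l * ((Real.exp (2 * l) * ∫ x, w s x * f x ∂(Measure.pi P))
              * (l * Real.exp (2 * l) * ∫ y, U s k y ^ 2 ∂(P k))) := by
            gcongr
      _ = _ := by
            rw [show (4 : ℝ) * l = 2 * l + 2 * l by ring, Real.exp_add]; ring
  -- the remainder is nonnegative and has small mean
  set g : (∀ i, X i) → ℝ := fun x => ∑ s, r s x * Real.exp (l * U s k (x k)) with hg_def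
  have hg : BddMeasurable g := BddMeasurable.sum _ fun s _ => (hr s).mul (ha s)
  have hgf : ∀ x, g x ≤ f x := by
    intro x
    have h1 : ∑ s, avgCoord P k (w s) x = 1 := by
      simp only [avgCoord]
      rw [← integral_finsetSum _ fun s _ => ((hw s).update x k).integrable _]
      simp [hw_def, sum_argmaxWeight]
    calc g x = ∑ s, avgCoord P k (w s) x * Real.exp (l * procSum U s x) := by
          refine Finset.sum_congr rfl fun s _ => ?_
          simp only [hr_def, mul_assoc, ← Real.exp_add]
          ring_nf
      _ ≤ ∑ s, avgCoord P k (w s) x * f x := by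
          refine Finset.sum_le_sum fun s _ => mul_le_mul_of_nonneg_left ?_ (hwavg s x)
          exact Real.exp_le_exp.2 (mul_le_mul_of_nonneg_left (procSum_le_procMax U s x) hl)
      _ = f x := by rw [← Finset.sum_mul, h1, one_mul]
  have hsum : ∑ s, ∫ x, w s x * f x ∂(Measure.pi P) = ∫ x, f x ∂(Measure.pi P) := by
    rw [← integral_finsetSum _ fun s _ => (hwf s).integrable _]
    refine integral_congr_ae (ae_of_all _ fun x => ?_)
    simp only [hw_def, ← Finset.sum_mul, sum_argmaxWeight, one_mul]
  have hrem : ∫ x, (f x - g x) * L x ∂(Measure.pi P)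
      ≤ 4 * l ^ 2 * ∑ s, ∫ x, w s x * f x * U s k (x k) ∂(Measure.pi P) := by
    have h1 : ∫ x, (f x - g x) * L x ∂(Measure.pi P)
        ≤ ∫ x, (f x - g x) * (4 * l) ∂(Measure.pi P) :=
      integral_mono (((hf.bddMeasurable.sub hg).mul hL).integrable _)
        (((hf.bddMeasurable.sub hg).mul (.const _)).integrable _) fun x =>
        mul_le_mul_of_nonneg_left (hL4 x) (sub_nonneg.2 (hgf x))
    have h2 : ∫ x, f x ∂(Measure.pi P) - ∫ x, g x ∂(Measure.pi P)
        ≤ l * ∑ s, ∫ x, w s x * f x * U s k (x k) ∂(Measure.pi P) := by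
      rw [hg_def, integral_finsetSum _ fun s _ => ((hr s).mul (ha s)).integrable _, ← hsum,
        Finset.mul_sum, ← Finset.sum_sub_distrib]
      refine Finset.sum_le_sum fun s _ => ?_
      rw [hra]
      have := mul_le_mul_of_nonneg_left (hU.one_le_integral_exp s k l) (hrnn s)
      linarith [hrint_ge s]
    rw [integral_mul_const, integral_sub (hf.bddMeasurable.integrable _) (hg.integrable _)] at h1
    nlinarith
  have hsplit : ∫ x, f x * L x ∂(Measure.pi P)
      = ∑ s, ∫ x, r s x * Real.exp (l * U s k (x k)) * L x ∂(Measure.pi P)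
        + ∫ x, (f x - g x) * L x ∂(Measure.pi P) := by
    rw [← integral_finsetSum _ fun s _ => (((hr s).mul (ha s)).mul hL).integrable _,
      ← integral_add ((BddMeasurable.sum _ fun s _ => ((hr s).mul (ha s)).mul hL).integrable _)
        (((hf.bddMeasurable.sub hg).mul hL).integrable _)]
    refine integral_congr_ae (ae_of_all _ fun x => ?_)
    simp only [hg_def, ← Finset.sum_mul]
    ring
  rw [hsplit, Finset.mul_sum]
  exact add_le_add (Finset.sum_le_sum fun s _ => comp s) hrem

/-- The entropy of `exp (l * procMax U)` under the product law. -/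
theorem IsCenteredFamily.entropy_le (hU : IsCenteredFamily P U) {v : ℝ}
    (hv : ∀ s, ∑ i, ∫ y, U s i y ^ 2 ∂(P i) ≤ v) {l : ℝ} (hl : 0 ≤ l) :
    ∫ x, Real.exp (l * procMax U x) * (l * procMax U x) ∂(Measure.pi P)
        - (∫ x, Real.exp (l * procMax U x) ∂(Measure.pi P))
          * Real.log (∫ x, Real.exp (l * procMax U x) ∂(Measure.pi P))
      ≤ l ^ 2 * Real.exp (4 * l) * v * ∫ x, Real.exp (l * procMax U x) ∂(Measure.pi P)
        + 4 * l ^ 2 * ∫ x, Real.exp (l * procMax U x) * procMax U x ∂(Measure.pi P) := by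
  have hf : PosBddMeasurable fun x => Real.exp (l * procMax U x) :=
    (hU.bddMeasurable_procMax.const_mul l).posBdd_exp
  have hw := fun s => hU.bddMeasurable_argmaxWeight s
  have hwf : ∀ s, BddMeasurable fun x => argmaxWeight U s x * Real.exp (l * procMax U x) :=
    fun s => (hw s).mul hf.bddMeasurable
  have h := (entropy_le_sum (P := P) hf).trans
    (Finset.sum_le_sum fun k _ => hU.entropy_coord_le k hl)
  simp only [Real.log_exp] at h
  rw [Finset.sum_add_distrib, ← Finset.mul_sum, ← Finset.mul_sum, Finset.sum_comm,
    Finset.sum_comm (f := fun k s => ∫ x, argmaxWeight U s x * Real.exp (l * procMax U x)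
      * U s k (x k) ∂(Measure.pi P))] at h
  have h1 : ∑ s, ∑ k, (∫ y, U s k y ^ 2 ∂(P k))
        * ∫ x, argmaxWeight U s x * Real.exp (l * procMax U x) ∂(Measure.pi P)
      ≤ v * ∫ x, Real.exp (l * procMax U x) ∂(Measure.pi P) := by
    calc _ ≤ ∑ s, v * ∫ x, argmaxWeight U s x * Real.exp (l * procMax U x) ∂(Measure.pi P) := by
          refine Finset.sum_le_sum fun s _ => ?_
          rw [← Finset.sum_mul]
          exact mul_le_mul_of_nonneg_right (hv s) (integral_nonneg fun x =>
            mul_nonneg (argmaxWeight_nonneg U s x) (Real.exp_pos _).le)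
      _ = _ := by
          rw [← Finset.mul_sum, ← integral_finsetSum _ fun s _ => (hwf s).integrable _]
          simp only [← Finset.sum_mul, sum_argmaxWeight, one_mul]
  have h2 : ∑ s, ∑ k, ∫ x, argmaxWeight U s x * Real.exp (l * procMax U x)
        * U s k (x k) ∂(Measure.pi P)
      = ∫ x, Real.exp (l * procMax U x) * procMax U x ∂(Measure.pi P) := by
    have e : ∀ s, ∑ k, ∫ x, argmaxWeight U s x * Real.exp (l * procMax U x)
        * U s k (x k) ∂(Measure.pi P)
        = ∫ x, argmaxWeight U s x * (Real.exp (l * procMax U x) * procMax U x)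
          ∂(Measure.pi P) := by
      intro s
      rw [← integral_finsetSum _ fun k _ =>
        ((hwf s).mul (hU.bddMeasurable_coord s k)).integrable _]
      refine integral_congr_ae (ae_of_all _ fun x => ?_)
      have h3 := argmaxWeight_mul U s x fun z => z
      simp only [← Finset.mul_sum] at h3 ⊢
      rw [show ∑ k, U s k (x k) = procSum U s x from rfl]
      linear_combination Real.exp (l * procMax U x) * h3
    rw [Finset.sum_congr rfl fun s _ => e s, ← integral_finsetSum _ fun s _ =>
      ((hw s).mul (hf.bddMeasurable.mul hU.bddMeasurable_procMax)).integrable _]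
    simp only [← Finset.sum_mul, sum_argmaxWeight, one_mul]
  rw [h2] at h
  refine h.trans ?_
  rw [mul_assoc (l ^ 2 * Real.exp (4 * l)) v]
  gcongr

end Concentration

open ProbabilityTheory in
/-- Herbst's argument: a bound on the entropies of `exp (l * F)` that is linear in the derivative of
the cumulant generating function integrates to a bound on that function. -/
lemma cgf_le_of_entropy_le {Ω : Type*} [MeasurableSpace Ω] {m : Measure Ω} [IsProbabilityMeasure m]
    {F : Ω → ℝ} (hF : BddMeasurable F) {l₀ B : ℝ} (hl₀ : 0 < l₀)
    (h : ∀ l, 0 < l → l ≤ l₀ → ∫ x, Real.exp (l * F x) * (l * F x) ∂m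
        - (∫ x, Real.exp (l * F x) ∂m) * Real.log (∫ x, Real.exp (l * F x) ∂m)
      ≤ l ^ 2 * B * ∫ x, Real.exp (l * F x) ∂m + 4 * l ^ 2 * ∫ x, Real.exp (l * F x) * F x ∂m) :
    (1 - 4 * l₀) * cgf F m l₀ ≤ l₀ * (∫ x, F x ∂m + B * l₀) := by
  have hint : ∀ l, Integrable (fun x => Real.exp (l * F x)) m := fun l =>
    (hF.const_mul l).posBdd_exp.bddMeasurable.integrable m
  have huniv : integrableExpSet F m = univ := eq_univ_of_forall hint
  have hmem : ∀ l, l ∈ interior (integrableExpSet F m) := by simp [huniv]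
  have hd : ∀ l, HasDerivAt (cgf F m) (deriv (cgf F m) l) l := fun l =>
    (analyticAt_cgf (hmem l)).differentiableAt.hasDerivAt
  set D : ℝ → ℝ := deriv (cgf F m) with hD
  have hbound : ∀ l, 0 < l → l ≤ l₀ →
      l * D l - cgf F m l ≤ l ^ 2 * B + 4 * l ^ 2 * D l := by
    intro l h0 h1
    have hM : 0 < mgf F m l := mgf_pos (hint l)
    have e1 : ∫ x, Real.exp (l * F x) * F x ∂m = D l * mgf F m l := by
      rw [hD, deriv_cgf (hmem l), div_mul_cancel₀ _ hM.ne']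
      exact integral_congr_ae (ae_of_all _ fun x => mul_comm _ _)
    have e2 : ∫ x, Real.exp (l * F x) * (l * F x) ∂m = l * (D l * mgf F m l) := by
      rw [← e1, ← integral_const_mul]
      exact integral_congr_ae (ae_of_all _ fun x => by ring)
    have h2 := h l h0 h1
    rw [e1, e2, show ∫ x, Real.exp (l * F x) ∂m = mgf F m l from rfl,
      show Real.log (mgf F m l) = cgf F m l from rfl] at h2
    by_contra hc
    push Not at hc
    nlinarith [mul_lt_mul_of_pos_right hc hM]
  set G : ℝ → ℝ := fun l => cgf F m l / l - 4 * cgf F m l - B * l with hG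
  have hGd : ∀ l, 0 < l →
      HasDerivAt G ((D l * l - cgf F m l * 1) / l ^ 2 - 4 * D l - B * 1) l := fun l h0 =>
    (((hd l).div (hasDerivAt_id l) h0.ne').sub ((hd l).const_mul 4)).sub
      ((hasDerivAt_id l).const_mul B)
  have hanti : AntitoneOn G (Ioc 0 l₀) := by
    refine antitoneOn_of_deriv_nonpos (convex_Ioc 0 l₀)
      (fun l hl => (hGd l hl.1).continuousAt.continuousWithinAt)
      (fun l hl => (hGd l (interior_subset hl).1).differentiableAt.differentiableWithinAt)
      fun l hl => ?_
    have hl' := interior_subset hl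
    rw [(hGd l hl'.1).deriv]
    have h1 := hbound l hl'.1 hl'.2
    have hl2 : 0 < l ^ 2 := pow_pos hl'.1 2
    have h2 : (D l * l - cgf F m l * 1) / l ^ 2 ≤ B + 4 * D l := by
      rw [div_le_iff₀ hl2]
      linarith
    linarith
  have hlim : Tendsto G (𝓝[>] 0) (𝓝 (∫ x, F x ∂m)) := by
    have h1 : Tendsto (fun l => cgf F m l / l) (𝓝[>] 0) (𝓝 (∫ x, F x ∂m)) := by
      have h2 := (hd 0).tendsto_slope_zero_right
      rw [hD, deriv_cgf_zero (hmem 0)] at h2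
      simp only [probReal_univ, div_one, zero_add, cgf_zero, sub_zero, smul_eq_mul] at h2
      refine h2.congr fun l => ?_
      rw [inv_mul_eq_div]
    have h3 : Tendsto (cgf F m) (𝓝[>] 0) (𝓝 0) := by
      have := (hd 0).continuousAt.tendsto.mono_left (nhdsWithin_le_nhds (s := Ioi 0))
      rwa [cgf_zero] at this
    have h4 : Tendsto (fun l : ℝ => B * l) (𝓝[>] 0) (𝓝 0) := by
      have : Continuous fun l : ℝ => B * l := by fun_prop
      simpa using (this.tendsto 0).mono_left (nhdsWithin_le_nhds (s := Ioi 0))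
    simpa using (h1.sub (h3.const_mul 4)).sub h4
  have hfin : G l₀ ≤ ∫ x, F x ∂m := by
    refine ge_of_tendsto hlim ?_
    filter_upwards [Ioc_mem_nhdsGT hl₀] with l hl
    exact hanti hl ⟨hl₀, le_rfl⟩ hl.2
  have e : (1 - 4 * l₀) * cgf F m l₀ = l₀ * (G l₀ + B * l₀) := by
    simp only [hG]
    field_simp
    ring
  rw [e]
  gcongr

section Concentration

variable {ι : Type*} [Fintype ι] [DecidableEq ι] {X : ι → Type*} [∀ i, MeasurableSpace (X i)]
  {P : ∀ i, Measure (X i)} [∀ i, IsProbabilityMeasure (P i)]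
  {κ : Type*} [Fintype κ] [Nonempty κ] {U : κ → ∀ i, X i → ℝ}

/-- An exponential deviation inequality for the maximum of finitely many sums of independent
centered variables; it involves only the mean of the maximum and the largest variance `v`. -/
theorem IsCenteredFamily.measure_procMax_ge_le (hU : IsCenteredFamily P U) {v : ℝ}
    (hv : ∀ s, ∑ i, ∫ y, U s i y ^ 2 ∂(P i) ≤ v) {l : ℝ} (hl : 0 < l) (hl4 : l < 1 / 4) (t : ℝ) :
    (Measure.pi P).real {x | t ≤ procMax U x}
      ≤ Real.exp (-l * t + l * (∫ x, procMax U x ∂(Measure.pi P) + Real.exp (4 * l) * v * l)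
          / (1 - 4 * l)) := by
  have hF := hU.bddMeasurable_procMax
  have hv0 : 0 ≤ v := (Finset.sum_nonneg fun i _ =>
    integral_nonneg fun y => sq_nonneg _).trans (hv (Classical.arbitrary κ))
  refine (ProbabilityTheory.measure_ge_le_exp_cgf t hl.le
    ((hF.const_mul l).posBdd_exp.bddMeasurable.integrable _)).trans (Real.exp_le_exp.2 ?_)
  have h := cgf_le_of_entropy_le (m := Measure.pi P) hF hl (B := Real.exp (4 * l) * v)
    fun u hu0 hul => by
      refine (hU.entropy_le hv hu0.le).trans ?_
      have h1 : Real.exp (4 * u) ≤ Real.exp (4 * l) := Real.exp_le_exp.2 (by linarith)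
      have h2 : 0 ≤ ∫ x, Real.exp (u * procMax U x) ∂(Measure.pi P) :=
        integral_nonneg fun x => (Real.exp_pos _).le
      rw [mul_assoc (u ^ 2) (Real.exp (4 * u))]
      gcongr
  have h4 : 0 < 1 - 4 * l := by linarith
  gcongr
  rw [le_div_iff₀ h4, mul_comm]
  exact h

end Concentration

/-! ### The Hellinger distance through a dominating measure -/

section Hellinger

variable {X : Type*} [MeasurableSpace X]

/-- The squared Hellinger distance may be computed with any dominating measure. -/
lemma hellingerSq_withDensity (ν : Measure X) {f g : X → ℝ≥0}
    (hf : Measurable f) (hg : Measurable g)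
    [IsFiniteMeasure (ν.withDensity fun x => (f x : ℝ≥0∞))]
    [IsFiniteMeasure (ν.withDensity fun x => (g x : ℝ≥0∞))] :
    hellingerSq (ν.withDensity fun x => (f x : ℝ≥0∞)) (ν.withDensity fun x => (g x : ℝ≥0∞))
      = (1 / 2) * ∫ x, (√(f x : ℝ) - √(g x : ℝ)) ^ 2 ∂ν := by
  unfold hellingerSq
  set P := ν.withDensity fun x => (f x : ℝ≥0∞) with hP
  set Q := ν.withDensity fun x => (g x : ℝ≥0∞) with hQ
  have hsum : P + Q = ν.withDensity fun x => ((f x + g x : ℝ≥0) : ℝ≥0∞) := by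
    rw [hP, hQ, ← withDensity_add_left hf.coe_nnreal_ennreal]
    congr 1
  have hfg : Measurable fun x => f x + g x := hf.add hg
  have key : ∀ h : X → ℝ≥0, Measurable h → (∀ x, h x ≤ f x + g x) →
      (ν.withDensity fun x => (h x : ℝ≥0∞)).rnDeriv (P + Q)
        =ᵐ[P + Q] fun x => ((h x / (f x + g x) : ℝ≥0) : ℝ≥0∞) := by
    intro h hh hle
    have hm : Measurable fun x => ((h x / (f x + g x) : ℝ≥0) : ℝ≥0∞) :=
      (hh.div hfg).coe_nnreal_ennreal
    have e : (ν.withDensity fun x => (h x : ℝ≥0∞))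
        = (P + Q).withDensity fun x => ((h x / (f x + g x) : ℝ≥0) : ℝ≥0∞) := by
      rw [hsum, ← withDensity_mul _ hfg.coe_nnreal_ennreal hm]
      congr 1
      ext x
      rw [Pi.mul_apply, ← ENNReal.coe_mul]
      congr 1
      by_cases h0 : f x + g x = 0
      · rw [h0, zero_mul]
        exact le_antisymm (h0 ▸ hle x) bot_le
      · rw [mul_div_cancel₀ _ h0]
    rw [e]
    exact Measure.rnDeriv_withDensity _ hm
  have kf := key f hf fun x => by simp
  have kg := key g hg fun x => by simp
  congr 1
  have e1 : ∫ x, (√((P.rnDeriv (P + Q) x).toReal) - √((Q.rnDeriv (P + Q) x).toReal)) ^ 2 ∂(P + Q)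
      = ∫ x, (√((f x / (f x + g x) : ℝ≥0) : ℝ) - √((g x / (f x + g x) : ℝ≥0) : ℝ)) ^ 2
        ∂(P + Q) := by
    refine integral_congr_ae ?_
    filter_upwards [kf, kg] with x h1 h2
    rw [h1, h2, ENNReal.coe_toReal, ENNReal.coe_toReal]
  rw [e1, hsum, integral_withDensity_eq_integral_smul hfg]
  refine integral_congr_ae (ae_of_all _ fun x => ?_)
  simp only [NNReal.smul_def, smul_eq_mul, NNReal.coe_div, NNReal.coe_add]
  have hf0 := (f x).coe_nonneg
  have hg0 := (g x).coe_nonneg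
  by_cases h0 : (f x : ℝ) + g x = 0
  · have h1 : (f x : ℝ) = 0 := by linarith
    have h2 : (g x : ℝ) = 0 := by linarith
    simp [h1, h2]
  · have hs : √((f x : ℝ) + g x) ^ 2 = f x + g x := Real.sq_sqrt (by positivity)
    have hs0 : √((f x : ℝ) + g x) ≠ 0 := by
      intro h
      rw [h] at hs
      apply h0
      rw [← hs]
      norm_num
    rw [Real.sqrt_div hf0, Real.sqrt_div hg0]
    nth_rewrite 1 [← hs]
    field_simp

lemma hellingerSq_nonneg (P Q : Measure X) : 0 ≤ hellingerSq P Q :=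
  mul_nonneg (by norm_num) (integral_nonneg fun x => sq_nonneg _)

lemma integrable_coe_of_lintegral_ne_top {ν : Measure X} {f : X → ℝ≥0} (hf : Measurable f)
    (h : ∫⁻ x, (f x : ℝ≥0∞) ∂ν ≠ ∞) : Integrable (fun x => (f x : ℝ)) ν := by
  refine ⟨hf.coe_nnreal_real.aestronglyMeasurable, ?_⟩
  rw [hasFiniteIntegral_iff_enorm]
  simpa using h.lt_top

lemma integral_coe_eq_one {ν : Measure X} {f : X → ℝ≥0} (hf : Measurable f)
    (h : ∫⁻ x, (f x : ℝ≥0∞) ∂ν = 1) : ∫ x, (f x : ℝ) ∂ν = 1 := by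
  have h1 := lintegral_coe_eq_integral f
    (integrable_coe_of_lintegral_ne_top (ν := ν) hf (by simp [h]))
  rw [h] at h1
  have h2 : 0 ≤ ∫ x, (f x : ℝ) ∂ν := integral_nonneg fun x => (f x).coe_nonneg
  have h3 := congrArg ENNReal.toReal h1
  rw [ENNReal.toReal_ofReal h2] at h3
  simpa using h3.symm

lemma isProbabilityMeasure_withDensity {ν : Measure X} {f : X → ℝ≥0}
    (h : ∫⁻ x, (f x : ℝ≥0∞) ∂ν = 1) :
    IsProbabilityMeasure (ν.withDensity fun x => (f x : ℝ≥0∞)) :=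
  ⟨by rw [withDensity_apply _ MeasurableSet.univ, Measure.restrict_univ, h]⟩

lemma integrable_sqrt_mul {ν : Measure X} {f g : X → ℝ≥0}
    (hf : Measurable f) (hg : Measurable g) (h1 : ∫⁻ x, (f x : ℝ≥0∞) ∂ν = 1)
    (h2 : ∫⁻ x, (g x : ℝ≥0∞) ∂ν = 1) : Integrable (fun x => √(f x * g x : ℝ)) ν := by
  refine Integrable.mono' ((integrable_coe_of_lintegral_ne_top hf (by simp [h1])).add
    (integrable_coe_of_lintegral_ne_top hg (by simp [h2])))
    (hf.coe_nnreal_real.mul hg.coe_nnreal_real).sqrt.aestronglyMeasurable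
    (ae_of_all _ fun x => ?_)
  have hf0 := (f x).coe_nonneg
  have hg0 := (g x).coe_nonneg
  rw [Real.norm_of_nonneg (Real.sqrt_nonneg _), Pi.add_apply]
  refine Real.sqrt_le_iff.2 ⟨by positivity, by nlinarith [mul_nonneg hf0 hg0]⟩

lemma sq_sqrt_sub_sqrt (a b : ℝ≥0) :
    (√(a : ℝ) - √(b : ℝ)) ^ 2 = a + b - 2 * √(a * b : ℝ) := by
  rw [Real.sqrt_mul a.coe_nonneg]
  nlinarith [Real.sq_sqrt a.coe_nonneg, Real.sq_sqrt b.coe_nonneg]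

lemma integrable_sq_sqrt_sub {ν : Measure X} {f g : X → ℝ≥0}
    (hf : Measurable f) (hg : Measurable g) (h1 : ∫⁻ x, (f x : ℝ≥0∞) ∂ν = 1)
    (h2 : ∫⁻ x, (g x : ℝ≥0∞) ∂ν = 1) :
    Integrable (fun x => (√(f x : ℝ) - √(g x : ℝ)) ^ 2) ν := by
  simp only [sq_sqrt_sub_sqrt]
  exact ((integrable_coe_of_lintegral_ne_top hf (by simp [h1])).add
    (integrable_coe_of_lintegral_ne_top hg (by simp [h2]))).sub
    ((integrable_sqrt_mul hf hg h1 h2).const_mul 2)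

/-- The squared Hellinger distance is one minus the Hellinger affinity. -/
lemma hellingerSq_eq_one_sub {ν : Measure X} {f g : X → ℝ≥0}
    (hf : Measurable f) (hg : Measurable g) (h1 : ∫⁻ x, (f x : ℝ≥0∞) ∂ν = 1)
    (h2 : ∫⁻ x, (g x : ℝ≥0∞) ∂ν = 1) :
    hellingerSq (ν.withDensity fun x => (f x : ℝ≥0∞)) (ν.withDensity fun x => (g x : ℝ≥0∞))
      = 1 - ∫ x, √(f x * g x : ℝ) ∂ν := by
  have := isProbabilityMeasure_withDensity h1
  have := isProbabilityMeasure_withDensity h2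
  have i1 := integrable_coe_of_lintegral_ne_top hf (ν := ν) (by simp [h1])
  have i2 := integrable_coe_of_lintegral_ne_top hg (ν := ν) (by simp [h2])
  have i3 := integrable_sqrt_mul hf hg h1 h2
  rw [hellingerSq_withDensity ν hf hg]
  simp only [sq_sqrt_sub_sqrt]
  have i12 : Integrable (fun x => (f x : ℝ) + g x) ν := i1.add i2
  rw [integral_sub i12 (i3.const_mul 2), integral_add i1 i2, integral_const_mul,
    integral_coe_eq_one hf h1, integral_coe_eq_one hg h2]
  ring

/-- A probability `R` and a σ-finite measure `μ` have densities with respect to a common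
measure. -/
lemma exists_common_density (R μ : Measure X) [IsProbabilityMeasure R] [SigmaFinite μ] :
    ∃ (ν : Measure X) (r m : X → ℝ≥0), Measurable r ∧ Measurable m ∧
      R = ν.withDensity (fun x => (r x : ℝ≥0∞)) ∧ ∫⁻ x, (r x : ℝ≥0∞) ∂ν = 1 ∧
      ∀ q : X → ℝ≥0, Measurable q →
        (μ.withDensity fun x => (q x : ℝ≥0∞))
          = ν.withDensity (fun x => ((m x * q x : ℝ≥0) : ℝ≥0∞)) ∧
        ∫⁻ x, ((m x * q x : ℝ≥0) : ℝ≥0∞) ∂ν = ∫⁻ x, (q x : ℝ≥0∞) ∂μ := by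
  have key : ∀ (S ν : Measure X) [SigmaFinite S] [SigmaFinite ν], S ≪ ν →
      S = ν.withDensity fun x => ((S.rnDeriv ν x).toNNReal : ℝ≥0∞) := by
    intro S ν _ _ h
    conv_lhs => rw [← Measure.withDensity_rnDeriv_eq S ν h]
    refine withDensity_congr_ae ?_
    filter_upwards [Measure.rnDeriv_ne_top S ν] with x hx
    rw [ENNReal.coe_toNNReal hx]
  have hR := key R (R + μ) (Measure.absolutelyContinuous_of_le (Measure.le_add_right le_rfl))
  have hμ := key μ (R + μ) (Measure.absolutelyContinuous_of_le (Measure.le_add_left le_rfl))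
  have mR : Measurable fun x => (R.rnDeriv (R + μ) x).toNNReal :=
    (Measure.measurable_rnDeriv _ _).ennreal_toNNReal
  have mμ : Measurable fun x => (μ.rnDeriv (R + μ) x).toNNReal :=
    (Measure.measurable_rnDeriv _ _).ennreal_toNNReal
  refine ⟨R + μ, fun x => (R.rnDeriv (R + μ) x).toNNReal,
    fun x => (μ.rnDeriv (R + μ) x).toNNReal, mR, mμ, hR, ?_, fun q hq => ?_⟩
  · have h1 : R univ = 1 := measure_univ
    rw [hR, withDensity_apply _ MeasurableSet.univ, Measure.restrict_univ] at h1
    exact h1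
  · have e : (μ.withDensity fun x => (q x : ℝ≥0∞)) = (R + μ).withDensity
        (fun x => (((μ.rnDeriv (R + μ) x).toNNReal * q x : ℝ≥0) : ℝ≥0∞)) := by
      conv_lhs => rw [hμ]
      rw [← withDensity_mul _ mμ.coe_nnreal_ennreal hq.coe_nnreal_ennreal]
      congr 1
    refine ⟨e, ?_⟩
    have h1 := congrArg (fun S : Measure X => S univ) e
    simp only [withDensity_apply _ MeasurableSet.univ, Measure.restrict_univ] at h1
    exact h1.symm

lemma hellingerSq_le_one {R μ : Measure X} [IsProbabilityMeasure R] [SigmaFinite μ] {q : X → ℝ≥0}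
    (hq : Measurable q) (h1 : ∫⁻ x, (q x : ℝ≥0∞) ∂μ = 1) :
    hellingerSq R (μ.withDensity fun x => (q x : ℝ≥0∞)) ≤ 1 := by
  obtain ⟨ν, r, m, hr, hm, hR, hr1, hν⟩ := exists_common_density R μ
  rw [(hν q hq).1]
  conv_lhs => rw [hR]
  have hmq : Measurable fun x => m x * q x := hm.mul hq
  rw [hellingerSq_eq_one_sub hr hmq hr1 ((hν q hq).2.trans h1)]
  have : 0 ≤ ∫ x, √(r x * (m x * q x : ℝ≥0) : ℝ) ∂ν := integral_nonneg fun x => Real.sqrt_nonneg _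
  linarith

/-- Upper semicontinuity of the Hellinger distance along pointwise convergent densities, a
consequence of Fatou's lemma for the affinity. -/
lemma eventually_hellingerSq_lt {R μ : Measure X} [IsProbabilityMeasure R] [SigmaFinite μ]
    {q : X → ℝ≥0} {u : ℕ → X → ℝ≥0} (hq : Measurable q) (hq1 : ∫⁻ x, (q x : ℝ≥0∞) ∂μ = 1)
    (hu : ∀ k, Measurable (u k)) (hu1 : ∀ k, ∫⁻ x, (u k x : ℝ≥0∞) ∂μ = 1)
    (hlim : ∀ x, Tendsto (fun k => u k x) atTop (𝓝 (q x))) {ε : ℝ} (hε : 0 < ε) :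
    ∀ᶠ k in atTop, hellingerSq R (μ.withDensity fun x => (u k x : ℝ≥0∞))
      < hellingerSq R (μ.withDensity fun x => (q x : ℝ≥0∞)) + ε := by
  obtain ⟨ν, r, m, hr, hm, hR, hr1, hν⟩ := exists_common_density R μ
  have aff : ∀ p : X → ℝ≥0, Measurable p → ∫⁻ x, (p x : ℝ≥0∞) ∂μ = 1 →
      hellingerSq R (μ.withDensity fun x => (p x : ℝ≥0∞))
        = 1 - ∫ x, √(r x * (m x * p x : ℝ≥0) : ℝ) ∂ν := by
    intro p hp hp1
    rw [(hν p hp).1]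
    conv_lhs => rw [hR]
    exact hellingerSq_eq_one_sub hr (hm.mul hp) hr1 ((hν p hp).2.trans hp1)
  have laff : ∀ p : X → ℝ≥0, Measurable p → ∫⁻ x, (p x : ℝ≥0∞) ∂μ = 1 →
      ∫⁻ x, ENNReal.ofReal (√(r x * (m x * p x : ℝ≥0) : ℝ)) ∂ν
        = ENNReal.ofReal (∫ x, √(r x * (m x * p x : ℝ≥0) : ℝ) ∂ν) := by
    intro p hp hp1
    exact (ofReal_integral_eq_lintegral_ofReal
      (integrable_sqrt_mul hr (hm.mul hp) hr1 ((hν p hp).2.trans hp1))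
      (ae_of_all _ fun x => Real.sqrt_nonneg _)).symm
  have fatou : ENNReal.ofReal (∫ x, √(r x * (m x * q x : ℝ≥0) : ℝ) ∂ν)
      ≤ liminf (fun k => ENNReal.ofReal (∫ x, √(r x * (m x * u k x : ℝ≥0) : ℝ) ∂ν)) atTop := by
    rw [← laff q hq hq1]
    simp only [← laff _ (hu _) (hu1 _)]
    refine le_trans (le_of_eq ?_) (lintegral_liminf_le fun k => ?_)
    · refine lintegral_congr fun x => ?_
      have hc : Continuous fun t : ℝ≥0 => ENNReal.ofReal (√(r x * (m x * t : ℝ≥0) : ℝ)) := by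
        exact ENNReal.continuous_ofReal.comp (by fun_prop)
      exact ((hc.tendsto (q x)).comp (hlim x)).liminf_eq.symm
    · exact (hr.coe_nnreal_real.mul (hm.mul (hu k)).coe_nnreal_real).sqrt.ennreal_ofReal
  set B := ∫ x, √(r x * (m x * q x : ℝ≥0) : ℝ) ∂ν with hB
  rcases le_or_gt B 0 with h0 | h0
  · refine Eventually.of_forall fun k => ?_
    rw [aff _ (hu k) (hu1 k), aff q hq hq1]
    have : 0 ≤ ∫ x, √(r x * (m x * u k x : ℝ≥0) : ℝ) ∂ν :=
      integral_nonneg fun x => Real.sqrt_nonneg _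
    linarith
  · have hlt : ENNReal.ofReal (B - ε)
        < liminf (fun k => ENNReal.ofReal (∫ x, √(r x * (m x * u k x : ℝ≥0) : ℝ) ∂ν)) atTop :=
      lt_of_lt_of_le ((ENNReal.ofReal_lt_ofReal_iff h0).2 (by linarith)) fatou
    filter_upwards [eventually_lt_of_lt_liminf hlt] with k hk
    rw [aff _ (hu k) (hu1 k), aff q hq hq1]
    have := ENNReal.lt_ofReal_iff_toReal_lt (by simp) |>.1 hk
    have h2 : B - ε ≤ (ENNReal.ofReal (B - ε)).toReal := by
      rw [ENNReal.toReal_ofReal']; exact le_max_left _ _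
    linarith

/-- A pointwise inequality between `φ` and the square roots of the densities integrates to a bound
on the mean of `φ`.  The densities `q` and `q'` integrate to one, so that their difference
contributes nothing. -/
lemma integral_le_of_pointwise {R μ : Measure X} [IsProbabilityMeasure R] [SigmaFinite μ]
    {q q' : X → ℝ≥0} (hq : Measurable q) (hq1 : ∫⁻ x, (q x : ℝ≥0∞) ∂μ = 1)
    (hq' : Measurable q') (hq1' : ∫⁻ x, (q' x : ℝ≥0∞) ∂μ = 1)
    {φ : X → ℝ} (hφ : BddMeasurable φ) (c α β : ℝ)
    (h : ∀ x (r m : ℝ≥0), r * φ x ≤ c * ((m * q' x : ℝ≥0) - (m * q x : ℝ≥0))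
      + α / 2 * (√(r : ℝ) - √((m * q x : ℝ≥0) : ℝ)) ^ 2
      + β / 2 * (√(r : ℝ) - √((m * q' x : ℝ≥0) : ℝ)) ^ 2) :
    ∫ x, φ x ∂(R) ≤ α * hellingerSq R (μ.withDensity fun x => (q x : ℝ≥0∞))
      + β * hellingerSq R (μ.withDensity fun x => (q' x : ℝ≥0∞)) := by
  obtain ⟨ν, r, m, hr, hm, hR, hr1, hν⟩ := exists_common_density R μ
  have hφi : Integrable (fun x => (r x : ℝ) * φ x) ν := by
    have h1 := hφ.integrable R
    rw [hR, integrable_withDensity_iff_integrable_smul hr] at h1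
    simpa only [NNReal.smul_def, smul_eq_mul] using h1
  have e1 : ∫ x, φ x ∂(R) = ∫ x, (r x : ℝ) * φ x ∂ν := by
    rw [hR, integral_withDensity_eq_integral_smul hr]
    simp only [NNReal.smul_def, smul_eq_mul]
  have hel : ∀ p : X → ℝ≥0, Measurable p → ∫⁻ x, (p x : ℝ≥0∞) ∂μ = 1 →
      hellingerSq R (μ.withDensity fun x => (p x : ℝ≥0∞))
        = (1 / 2) * ∫ x, (√(r x : ℝ) - √((m x * p x : ℝ≥0) : ℝ)) ^ 2 ∂ν := by
    intro p hp hp1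
    have := isProbabilityMeasure_withDensity hr1
    have := isProbabilityMeasure_withDensity ((hν p hp).2.trans hp1)
    rw [(hν p hp).1]
    conv_lhs => rw [hR]
    exact hellingerSq_withDensity ν hr (hm.mul hp)
  have hmq : Measurable fun x => m x * q x := hm.mul hq
  have hmq' : Measurable fun x => m x * q' x := hm.mul hq'
  have n1 := (hν q hq).2.trans hq1
  have n1' := (hν q' hq').2.trans hq1'
  have i1 := integrable_coe_of_lintegral_ne_top hmq (ν := ν) (by simp_all)
  have i1' := integrable_coe_of_lintegral_ne_top hmq' (ν := ν) (by simp_all)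
  have i2 := integrable_sq_sqrt_sub hr hmq hr1 n1
  have i2' := integrable_sq_sqrt_sub hr hmq' hr1 n1'
  have key := integral_mono hφi ((((i1'.sub i1).const_mul c).add (i2.const_mul (α / 2))).add
    (i2'.const_mul (β / 2))) fun x => h x (r x) (m x)
  rw [integral_add' (((i1'.sub i1).const_mul c).add (i2.const_mul (α / 2)))
    (i2'.const_mul (β / 2)), integral_add' ((i1'.sub i1).const_mul c) (i2.const_mul (α / 2)),
    integral_const_mul, integral_const_mul, integral_const_mul, integral_sub' i1' i1] at key
  rw [show ∫ x, ((m x * q' x : ℝ≥0) : ℝ) ∂ν = 1 from integral_coe_eq_one hmq' n1',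
    show ∫ x, ((m x * q x : ℝ≥0) : ℝ) ∂ν = 1 from integral_coe_eq_one hmq n1] at key
  rw [e1, hel q hq hq1, hel q' hq' hq1']
  linarith

end Hellinger

section

/-! ### The density ratio -/

lemma ratio_inv (a b : ℝ≥0) : (ratio a b)⁻¹ = ratio b a := by
  unfold ratio
  by_cases h : a = 0 ∧ b = 0
  · simp [h]
  · rw [if_neg h, if_neg (by tauto), ENNReal.inv_div (by simp)]
    by_cases hb : b = 0
    · right; simpa [hb] using h
    · left; simp [hb]

lemma ratio_self (a : ℝ≥0) : ratio a a = 1 := by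
  unfold ratio
  by_cases h : a = 0
  · simp [h]
  · rw [if_neg (by tauto), ENNReal.div_self (by simpa using h) (by simp)]

lemma ratio_of_ne_zero {a b : ℝ≥0} (hb : b ≠ 0) : ratio a b = (a : ℝ≥0∞) / b := by
  unfold ratio
  rw [if_neg (by tauto)]

lemma ratio_zero_right {a : ℝ≥0} (ha : a ≠ 0) : ratio a 0 = ∞ := by
  unfold ratio
  rw [if_neg (by tauto), ENNReal.coe_zero, ENNReal.div_zero (by simpa using ha)]

lemma psiRatio_swap {ψ : ℝ≥0∞ → ℝ} (hinv : ∀ x, ψ x⁻¹ = -ψ x) (q q' : ℝ≥0) :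
    psiRatio ψ q' q = -psiRatio ψ q q' := by
  unfold psiRatio
  rw [← hinv, ← ratio_inv q' q, ENNReal.inv_rpow]

lemma measurable_psiRatio {Ω : Type*} [MeasurableSpace Ω] {ψ : ℝ≥0∞ → ℝ} (hψ : Continuous ψ)
    {f g : Ω → ℝ≥0} (hf : Measurable f) (hg : Measurable g) :
    Measurable fun x => psiRatio ψ (f x) (g x) := by
  have h : Measurable fun x => ratio (g x) (f x) := by
    unfold ratio
    refine Measurable.ite ?_ measurable_const
      (hg.coe_nnreal_ennreal.div hf.coe_nnreal_ennreal)
    exact (hg (measurableSet_singleton 0)).inter (hf (measurableSet_singleton 0))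
  exact hψ.measurable.comp (h.pow_const _)

/-- Along densities that converge and vanish eventually where their limit vanishes, the statistic
converges. -/
lemma tendsto_psiRatio {ψ : ℝ≥0∞ → ℝ} (hψ : Continuous ψ) (q : ℝ≥0) {q' : ℝ≥0} {u : ℕ → ℝ≥0}
    (hu : Tendsto u atTop (𝓝 q')) (hu0 : q' = 0 → ∀ᶠ k in atTop, u k = 0) :
    Tendsto (fun k => psiRatio ψ q (u k)) atTop (𝓝 (psiRatio ψ q q')) := by
  by_cases h0 : q' = 0
  · refine tendsto_const_nhds.congr' ?_
    filter_upwards [hu0 h0] with k hk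
    rw [hk, h0]
  by_cases hq : q = 0
  · refine tendsto_const_nhds.congr' ?_
    filter_upwards [hu.eventually_ne h0] with k hk
    simp only [psiRatio, hq, ratio_zero_right hk, ratio_zero_right h0]
  · unfold psiRatio
    simp only [ratio_of_ne_zero hq]
    have h1 : Tendsto (fun k => (u k : ℝ≥0∞) / q) atTop (𝓝 ((q' : ℝ≥0∞) / q)) :=
      ENNReal.Tendsto.div_const (ENNReal.tendsto_coe.2 hu) (Or.inr (by simpa using hq))
    exact (hψ.tendsto _).comp ((ENNReal.continuous_rpow_const.tendsto _).comp h1)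

/-! ### The functions `psi₁` and `psi₂` -/

lemma sqrt_ratio_of_ne_zero (q q' : ℝ≥0) (hq : q ≠ 0) :
    ratio q' q ^ (1 / 2 : ℝ) = ((NNReal.sqrt q' / NNReal.sqrt q : ℝ≥0) : ℝ≥0∞) := by
  rw [ratio_of_ne_zero hq, ← ENNReal.coe_div hq, ← ENNReal.coe_rpow_of_nonneg _ (by norm_num),
    ← NNReal.sqrt_eq_rpow, NNReal.sqrt_div]

lemma psiRatio_psi₁ (q q' : ℝ≥0) :
    psiRatio psi₁ q q' = (√(q' : ℝ) - √(q : ℝ)) / (√(q' : ℝ) + √(q : ℝ)) := by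
  by_cases hq : q = 0
  · by_cases hq' : q' = 0
    · simp [psiRatio, hq, hq', ratio_self, psi₁]
    · have h : √(q' : ℝ) ≠ 0 := by
        rw [Real.sqrt_ne_zero']; exact_mod_cast pos_iff_ne_zero.2 hq'
      simp [psiRatio, hq, ratio_zero_right hq', psi₁, div_self h]
  · have h : 0 < √(q : ℝ) := Real.sqrt_pos.2 (by exact_mod_cast pos_iff_ne_zero.2 hq)
    have h' := Real.sqrt_nonneg (q' : ℝ)
    rw [psiRatio, sqrt_ratio_of_ne_zero q q' hq, psi₁, if_neg ENNReal.coe_ne_top,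
      ENNReal.coe_toReal]
    simp only [NNReal.coe_div, Real.coe_sqrt]
    field_simp

lemma psiRatio_psi₂ (q q' : ℝ≥0) :
    psiRatio psi₂ q q' = (√(q' : ℝ) - √(q : ℝ)) / √((q' : ℝ) + q) := by
  by_cases hq : q = 0
  · by_cases hq' : q' = 0
    · simp [psiRatio, hq, hq', ratio_self, psi₂]
    · have h : √(q' : ℝ) ≠ 0 := by
        rw [Real.sqrt_ne_zero']; exact_mod_cast pos_iff_ne_zero.2 hq'
      simp [psiRatio, hq, ratio_zero_right hq', psi₂, div_self h]
  · have h : 0 < √(q : ℝ) := Real.sqrt_pos.2 (by exact_mod_cast pos_iff_ne_zero.2 hq)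
    have h' := Real.sqrt_nonneg (q' : ℝ)
    rw [psiRatio, sqrt_ratio_of_ne_zero q q' hq, psi₂, if_neg ENNReal.coe_ne_top,
      ENNReal.coe_toReal]
    simp only [NNReal.coe_div, Real.coe_sqrt]
    have e : (√(q' : ℝ) / √(q : ℝ)) ^ 2 + 1 = ((q' : ℝ) + q) / q := by
      have hq0 : (q : ℝ) ≠ 0 := by exact_mod_cast hq
      rw [div_pow, Real.sq_sqrt q'.coe_nonneg, Real.sq_sqrt q.coe_nonneg]
      field_simp
    rw [e, Real.sqrt_div (by positivity)]
    have h2 : 0 < √((q' : ℝ) + q) :=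
      Real.sqrt_pos.2 (by have := pos_iff_ne_zero.2 hq; positivity)
    field_simp

lemma continuous_toReal_inv_one_add {φ : ℝ≥0∞ → ℝ≥0∞} (hφ : Continuous φ) :
    Continuous fun x => ((1 + φ x)⁻¹).toReal := by
  refine ENNReal.continuousOn_toReal.comp_continuous ?_ fun x => ?_
  · exact (continuous_const.add hφ).inv
  · simp

lemma psi₁_eq (x : ℝ≥0∞) : psi₁ x = 1 - 2 * ((1 + x)⁻¹).toReal := by
  unfold psi₁
  split_ifs with h
  · simp [h]
  · have h0 : 0 ≤ x.toReal := ENNReal.toReal_nonneg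
    rw [ENNReal.toReal_inv, ENNReal.toReal_add (by simp) h, ENNReal.toReal_one]
    field_simp
    ring

lemma continuous_psi₁ : Continuous psi₁ := by
  rw [show psi₁ = fun x => 1 - 2 * ((1 + x)⁻¹).toReal from funext psi₁_eq]
  exact continuous_const.sub (continuous_const.mul (continuous_toReal_inv_one_add continuous_id))

lemma psi₂_eq (x : ℝ≥0∞) :
    psi₂ x = √((1 + (x ^ 2)⁻¹)⁻¹).toReal - √((1 + x ^ 2)⁻¹).toReal := by
  unfold psi₂
  split_ifs with h
  · simp [h]
  · have h0 : 0 ≤ x.toReal := ENNReal.toReal_nonneg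
    by_cases hx : x = 0
    · simp [hx]
    have hx' : 0 < x.toReal := ENNReal.toReal_pos hx h
    have h2 : x ^ 2 ≠ ∞ := ENNReal.pow_ne_top h
    have h3 : (x ^ 2)⁻¹ ≠ ∞ := ENNReal.inv_ne_top.2 (pow_ne_zero 2 hx)
    rw [ENNReal.toReal_inv, ENNReal.toReal_add (by simp) h3, ENNReal.toReal_inv,
      ENNReal.toReal_inv, ENNReal.toReal_add (by simp) h2, ENNReal.toReal_one,
      ENNReal.toReal_pow]
    have e : (1 + (x.toReal ^ 2)⁻¹)⁻¹ = x.toReal ^ 2 / (x.toReal ^ 2 + 1) := by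
      field_simp
    rw [e, Real.sqrt_div (by positivity), Real.sqrt_sq h0, Real.sqrt_inv, add_comm (1 : ℝ)]
    ring

lemma continuous_psi₂ : Continuous psi₂ := by
  rw [show psi₂ = fun x => √((1 + (x ^ 2)⁻¹)⁻¹).toReal - √((1 + x ^ 2)⁻¹).toReal from
    funext psi₂_eq]
  have h : Continuous fun x : ℝ≥0∞ => x ^ 2 := ENNReal.continuous_pow 2
  exact (continuous_toReal_inv_one_add h.inv).sqrt.sub (continuous_toReal_inv_one_add h).sqrt

lemma psi₁_inv (x : ℝ≥0∞) : psi₁ x⁻¹ = -psi₁ x := by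
  by_cases h : x = ∞
  · simp [h, psi₁]
  by_cases h0 : x = 0
  · simp [h0, psi₁]
  have hx : 0 < x.toReal := ENNReal.toReal_pos h0 h
  simp only [psi₁, ENNReal.inv_eq_top, h, h0, if_false, ENNReal.toReal_inv]
  field_simp
  ring

lemma psi₂_inv (x : ℝ≥0∞) : psi₂ x⁻¹ = -psi₂ x := by
  rw [psi₂_eq, psi₂_eq, ← ENNReal.inv_pow, inv_inv]
  ring

lemma abs_psi₁_le (x : ℝ≥0∞) : |psi₁ x| ≤ 1 := by
  unfold psi₁
  split_ifs
  · simp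
  · have h0 : 0 ≤ x.toReal := ENNReal.toReal_nonneg
    rw [abs_div, abs_of_pos (show 0 < x.toReal + 1 by linarith), div_le_one (by linarith), abs_le]
    constructor <;> linarith

lemma abs_psi₂_le (x : ℝ≥0∞) : |psi₂ x| ≤ 1 := by
  unfold psi₂
  split_ifs
  · simp
  · have h0 : 0 ≤ x.toReal := ENNReal.toReal_nonneg
    have h1 : 0 < √(x.toReal ^ 2 + 1) := Real.sqrt_pos.2 (by positivity)
    rw [abs_div, abs_of_pos h1, div_le_one h1]
    exact Real.abs_le_sqrt (by nlinarith)

/-! ### The moment conditions for `psi₁` and `psi₂` -/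

/-- The pointwise inequality behind the first moment condition: `t`, `a`, `b` are the square roots
of the densities of the true law and of the two laws that are compared.  The hypothesis on
`a ^ 2 * φ` is the case `t = a`. -/
lemma first_moment_pointwise {t a b φ c : ℝ} (hφ : |φ| ≤ 1) (ha : |a * φ| ≤ |b - a|)
    (h : a ^ 2 * φ ≤ c * (b ^ 2 - a ^ 2) - (b - a) ^ 2 / 4) :
    t ^ 2 * φ ≤ c * (b ^ 2 - a ^ 2) + 48 / 2 * (t - a) ^ 2 + -(3 / 8) / 2 * (t - b) ^ 2 := by
  have h1 : t ^ 2 * φ = a ^ 2 * φ + 2 * ((t - a) * (a * φ)) + (t - a) ^ 2 * φ := by ring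
  have h2 : (t - a) * (a * φ) ≤ |t - a| * |b - a| := by
    refine (le_abs_self _).trans ?_
    rw [abs_mul]
    gcongr
  have h3 : (t - a) ^ 2 * φ ≤ |t - a| ^ 2 := by
    rw [sq_abs]
    nlinarith [(abs_le.1 hφ).2, sq_nonneg (t - a)]
  have h4 : (t - b) ^ 2 ≤ (|t - a| + |b - a|) ^ 2 := by
    rw [← sq_abs (t - b)]
    have : |t - b| ≤ |t - a| + |b - a| := by
      rw [abs_sub_comm b a]
      exact abs_sub_le t a b
    gcongr
  rw [← sq_abs (b - a)] at h
  rw [h1, ← sq_abs (t - a)] at *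
  nlinarith [sq_nonneg (19 * |t - a| - |b - a|), sq_nonneg |t - a|]

/-- The pointwise inequality behind the second moment condition. -/
lemma second_moment_pointwise {t a b φ κ : ℝ} (ha : 0 ≤ a) (hb : 0 ≤ b) (hκ : 0 ≤ κ)
    (hφ : |φ| ≤ 1) (h : (a + b) * |φ| ≤ κ * |b - a|) :
    t ^ 2 * φ ^ 2 ≤ (1 + κ) ^ 2 / 2 * (t - a) ^ 2 + (1 + κ) ^ 2 / 2 * (t - b) ^ 2 := by
  have h1 : |t| ≤ (|t - a| + |t - b|) / 2 + (a + b) / 2 := by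
    have h2 : |t| ≤ |t - a| + a := by
      have := abs_add_le (t - a) a
      rwa [sub_add_cancel, abs_of_nonneg ha] at this
    have h3 : |t| ≤ |t - b| + b := by
      have := abs_add_le (t - b) b
      rwa [sub_add_cancel, abs_of_nonneg hb] at this
    linarith
  have h4 : |b - a| ≤ |t - a| + |t - b| := by
    rw [abs_sub_comm t b, add_comm]
    exact abs_sub_le b t a
  have h5 : |t| * |φ| ≤ (1 + κ) / 2 * (|t - a| + |t - b|) := by
    calc |t| * |φ| ≤ ((|t - a| + |t - b|) / 2 + (a + b) / 2) * |φ| := by gcongr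
      _ = (|t - a| + |t - b|) / 2 * |φ| + ((a + b) * |φ|) / 2 := by ring
      _ ≤ (|t - a| + |t - b|) / 2 * 1 + (κ * (|t - a| + |t - b|)) / 2 := by
        have := h.trans (mul_le_mul_of_nonneg_left h4 hκ)
        gcongr
      _ = _ := by ring
  calc t ^ 2 * φ ^ 2 = (|t| * |φ|) ^ 2 := by rw [mul_pow, sq_abs, sq_abs]
    _ ≤ ((1 + κ) / 2 * (|t - a| + |t - b|)) ^ 2 := by gcongr
    _ = (1 + κ) ^ 2 / 4 * (|t - a| + |t - b|) ^ 2 := by ring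
    _ ≤ (1 + κ) ^ 2 / 4 * (2 * (|t - a| ^ 2 + |t - b| ^ 2)) := by
      gcongr
      nlinarith [sq_nonneg (|t - a| - |t - b|)]
    _ = _ := by rw [sq_abs, sq_abs]; ring

variable {n : ℕ} {X : Fin n → Type*} [∀ i, MeasurableSpace (X i)]

/-- The moment conditions follow from three inequalities between `φ = psiRatio ψ q q'` and the
square roots `s = √q`, `s' = √q'`. -/
lemma momentConditions_of_pointwise {ψ : ℝ≥0∞ → ℝ} (hψ : Continuous ψ) (hψ1 : ∀ x, |ψ x| ≤ 1)
    {c κ a₂ : ℝ} (hκ : 0 ≤ κ) (ha₂ : (1 + κ) ^ 2 ≤ a₂ ^ 2)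
    (h1 : ∀ q q' : ℝ≥0, √(q : ℝ) * |psiRatio ψ q q'| ≤ |√(q' : ℝ) - √(q : ℝ)|)
    (h2 : ∀ q q' : ℝ≥0,
      q * psiRatio ψ q q' ≤ c * (q' - q) - (√(q' : ℝ) - √(q : ℝ)) ^ 2 / 4)
    (h3 : ∀ q q' : ℝ≥0,
      (√(q : ℝ) + √(q' : ℝ)) * |psiRatio ψ q q'| ≤ κ * |√(q' : ℝ) - √(q : ℝ)|)
    (μ : ∀ i, Measure (X i)) [∀ i, SigmaFinite (μ i)] (𝒬 : Set (∀ i, X i → ℝ≥0))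
    (h𝒬 : ∀ q ∈ 𝒬, IsDensity μ q) : MomentConditions ψ 48 (3 / 8) a₂ μ 𝒬 := by
  have hb : ∀ q ∈ 𝒬, ∀ q' ∈ 𝒬, ∀ i, BddMeasurable fun x => psiRatio ψ (q i x) (q' i x) :=
    fun q hq q' hq' i => ⟨measurable_psiRatio hψ ((h𝒬 q hq).measurable i)
      ((h𝒬 q' hq').measurable i), 1, fun x => hψ1 _⟩
  have hsq : ∀ m q : ℝ≥0, √((m * q : ℝ≥0) : ℝ) = √(m : ℝ) * √(q : ℝ) := fun m q => by
    rw [NNReal.coe_mul, Real.sqrt_mul m.coe_nonneg]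
  constructor
  · intro q hq q' hq' i R hR
    have := integral_le_of_pointwise (R := R) (μ := μ i) ((h𝒬 q hq).measurable i)
      ((h𝒬 q hq).lintegral_eq_one i) ((h𝒬 q' hq').measurable i)
      ((h𝒬 q' hq').lintegral_eq_one i) (hb q hq q' hq' i) c 48 (-(3 / 8)) fun x r m => by
        have hp := first_moment_pointwise (t := √(r : ℝ)) (a := √((m * q i x : ℝ≥0) : ℝ))
          (b := √((m * q' i x : ℝ≥0) : ℝ)) (φ := psiRatio ψ (q i x) (q' i x)) (c := c)
          (hψ1 _) ?_ ?_
        · rwa [Real.sq_sqrt r.coe_nonneg, Real.sq_sqrt (NNReal.coe_nonneg _),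
            Real.sq_sqrt (NNReal.coe_nonneg _)] at hp
        · rw [hsq, hsq, ← mul_sub, abs_mul, abs_mul, abs_mul, abs_of_nonneg (Real.sqrt_nonneg _),
            abs_of_nonneg (Real.sqrt_nonneg _), mul_assoc]
          exact mul_le_mul_of_nonneg_left (h1 _ _) (Real.sqrt_nonneg _)
        · have h4 := mul_le_mul_of_nonneg_left (h2 (q i x) (q' i x)) m.coe_nonneg
          rw [Real.sq_sqrt (NNReal.coe_nonneg _), Real.sq_sqrt (NNReal.coe_nonneg _), hsq, hsq,
            ← mul_sub, mul_pow, Real.sq_sqrt m.coe_nonneg, NNReal.coe_mul, NNReal.coe_mul]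
          linarith
    unfold law
    linarith
  · intro q hq q' hq' i R hR
    have hb2 : BddMeasurable fun x => psiRatio ψ (q i x) (q' i x) ^ 2 := by
      simpa only [sq] using (hb q hq q' hq' i).mul (hb q hq q' hq' i)
    have := integral_le_of_pointwise (R := R) (μ := μ i) ((h𝒬 q hq).measurable i)
      ((h𝒬 q hq).lintegral_eq_one i) ((h𝒬 q' hq').measurable i)
      ((h𝒬 q' hq').lintegral_eq_one i) hb2 0 ((1 + κ) ^ 2) ((1 + κ) ^ 2) fun x r m => by
        have hp := second_moment_pointwise (t := √(r : ℝ)) (a := √((m * q i x : ℝ≥0) : ℝ))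
          (b := √((m * q' i x : ℝ≥0) : ℝ)) (φ := psiRatio ψ (q i x) (q' i x))
          (Real.sqrt_nonneg _) (Real.sqrt_nonneg _) hκ (hψ1 _) ?_
        · rw [Real.sq_sqrt r.coe_nonneg] at hp
          linarith
        · rw [hsq, hsq, ← mul_sub, ← mul_add, abs_mul, abs_of_nonneg (Real.sqrt_nonneg _),
            mul_assoc, mul_left_comm κ]
          exact mul_le_mul_of_nonneg_left (h3 _ _) (Real.sqrt_nonneg _)
    have hh := add_nonneg (hellingerSq_nonneg R (law μ q i)) (hellingerSq_nonneg R (law μ q' i))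
    have h5 := mul_le_mul_of_nonneg_right ha₂ hh
    unfold law at h5 ⊢
    linarith

lemma momentConditions_psi₁ (μ : ∀ i, Measure (X i)) [∀ i, SigmaFinite (μ i)]
    (𝒬 : Set (∀ i, X i → ℝ≥0)) (h𝒬 : ∀ q ∈ 𝒬, IsDensity μ q) :
    MomentConditions psi₁ 48 (3 / 8) √(3 * √2) μ 𝒬 := by
  have h2 : (4 : ℝ) / 3 ≤ √2 := Real.le_sqrt_of_sq_le (by norm_num)
  have key : ∀ q q' : ℝ≥0, (√(q' : ℝ) + √(q : ℝ)) * psiRatio psi₁ q q' = √(q' : ℝ) - √(q : ℝ) := by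
    intro q q'
    rw [psiRatio_psi₁]
    have h0 := Real.sqrt_nonneg (q : ℝ)
    have h0' := Real.sqrt_nonneg (q' : ℝ)
    by_cases h : √(q' : ℝ) + √(q : ℝ) = 0
    · rw [h]; linarith
    · rw [mul_div_cancel₀ _ h]
  have key' : ∀ q q' : ℝ≥0,
      (√(q' : ℝ) + √(q : ℝ)) * |psiRatio psi₁ q q'| = |√(q' : ℝ) - √(q : ℝ)| := by
    intro q q'
    rw [← key, abs_mul, abs_of_nonneg (add_nonneg (Real.sqrt_nonneg _) (Real.sqrt_nonneg _))]
  refine momentConditions_of_pointwise continuous_psi₁ abs_psi₁_le (c := 1 / 4) zero_le_one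
    ?_ ?_ ?_ ?_ μ 𝒬 h𝒬
  · rw [Real.sq_sqrt (by positivity)]
    linarith
  · intro q q'
    rw [← key' q q']
    exact mul_le_mul_of_nonneg_right (by linarith [Real.sqrt_nonneg (q' : ℝ)]) (abs_nonneg _)
  · intro q q'
    have hs := Real.sq_sqrt q.coe_nonneg
    have hs' := Real.sq_sqrt q'.coe_nonneg
    have h0 := Real.sqrt_nonneg (q : ℝ)
    have h0' := Real.sqrt_nonneg (q' : ℝ)
    have hk := key q q'
    have hφ := abs_psi₁_le (ratio q' q ^ (1 / 2 : ℝ))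
    change |psiRatio psi₁ q q'| ≤ 1 at hφ
    set φ := psiRatio psi₁ q q'
    set s := √(q : ℝ)
    set s' := √(q' : ℝ)
    rw [← hs, ← hs', ← hk]
    -- the right side exceeds the left one by `(s' + s) ^ 2 * φ ^ 2 * (1 - φ) / 4`
    have e : s = (s' + s) * (1 - φ) / 2 := by linarith
    have hφ' := abs_le.1 hφ
    have e1 : s ^ 2 * φ = (s' + s) ^ 2 * ((1 - φ) ^ 2 * φ / 4) := by
      nth_rewrite 1 [e]; ring
    have e2 : s' ^ 2 - s ^ 2 = (s' + s) ^ 2 * φ := by linear_combination (-(s' + s)) * hk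
    rw [e1, e2]
    have e3 : 0 ≤ φ ^ 2 * (1 - φ) := mul_nonneg (sq_nonneg _) (by linarith)
    nlinarith [mul_nonneg (sq_nonneg (s' + s)) e3]
  · intro q q'
    rw [add_comm, key', one_mul]

lemma momentConditions_psi₂ (μ : ∀ i, Measure (X i)) [∀ i, SigmaFinite (μ i)]
    (𝒬 : Set (∀ i, X i → ℝ≥0)) (h𝒬 : ∀ q ∈ 𝒬, IsDensity μ q) :
    MomentConditions psi₂ 48 (3 / 8) √(3 + 2 * √2) μ 𝒬 := by
  have h22 : √(2 : ℝ) ^ 2 = 2 := Real.sq_sqrt (by norm_num)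
  have key : ∀ q q' : ℝ≥0, √((q' : ℝ) + q) * psiRatio psi₂ q q' = √(q' : ℝ) - √(q : ℝ) := by
    intro q q'
    rw [psiRatio_psi₂]
    by_cases h : √((q' : ℝ) + q) = 0
    · rw [Real.sqrt_eq_zero (by positivity)] at h
      have h1 : (q : ℝ) = 0 := by linarith [q.coe_nonneg, q'.coe_nonneg]
      have h2 : (q' : ℝ) = 0 := by linarith [q.coe_nonneg, q'.coe_nonneg]
      simp [h1, h2]
    · rw [mul_div_cancel₀ _ h]
  have key' : ∀ q q' : ℝ≥0,
      √((q' : ℝ) + q) * |psiRatio psi₂ q q'| = |√(q' : ℝ) - √(q : ℝ)| := by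
    intro q q'
    rw [← key, abs_mul, abs_of_nonneg (Real.sqrt_nonneg _)]
  have hsum : ∀ q q' : ℝ≥0, √(q : ℝ) + √(q' : ℝ) ≤ √2 * √((q' : ℝ) + q) := by
    intro q q'
    rw [← Real.sqrt_mul (by norm_num)]
    apply Real.le_sqrt_of_sq_le
    nlinarith [Real.sq_sqrt q.coe_nonneg, Real.sq_sqrt q'.coe_nonneg,
      sq_nonneg (√(q : ℝ) - √(q' : ℝ))]
  refine momentConditions_of_pointwise continuous_psi₂ abs_psi₂_le (c := √2 / 4)
    (Real.sqrt_nonneg 2) ?_ ?_ ?_ ?_ μ 𝒬 h𝒬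
  · rw [Real.sq_sqrt (by positivity)]
    nlinarith
  · intro q q'
    rw [← key' q q']
    exact mul_le_mul_of_nonneg_right (Real.sqrt_le_sqrt (by linarith [q'.coe_nonneg]))
      (abs_nonneg _)
  · intro q q'
    have hs := Real.sq_sqrt q.coe_nonneg
    have hs' := Real.sq_sqrt q'.coe_nonneg
    have h0 := Real.sqrt_nonneg (q : ℝ)
    have h0' := Real.sqrt_nonneg (q' : ℝ)
    have hk := key q q'
    have hr : (1 : ℝ) ≤ √2 := Real.one_le_sqrt.2 (by norm_num)
    -- `√(q + q')` is at least `√2 * √q` where `psi₂ ≥ 0` and at most that where `psi₂ ≤ 0`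
    have hmain : √2 * √(q : ℝ) * psiRatio psi₂ q q' ≤ √(q' : ℝ) - √(q : ℝ) := by
      rw [← hk]
      have h2q : √2 * √(q : ℝ) = √(2 * q) := (Real.sqrt_mul (by norm_num) _).symm
      have hden := Real.sqrt_nonneg ((q' : ℝ) + q)
      rcases le_total (q : ℝ) q' with h | h
      · refine mul_le_mul_of_nonneg_right (h2q ▸ Real.sqrt_le_sqrt (by linarith)) ?_
        rw [psiRatio_psi₂]
        exact div_nonneg (sub_nonneg.2 (Real.sqrt_le_sqrt h)) hden
      · refine mul_le_mul_of_nonpos_right (h2q ▸ Real.sqrt_le_sqrt (by linarith)) ?_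
        rw [psiRatio_psi₂]
        exact div_nonpos_of_nonpos_of_nonneg (sub_nonpos.2 (Real.sqrt_le_sqrt h)) hden
    set φ := psiRatio psi₂ q q'
    set s := √(q : ℝ)
    set s' := √(q' : ℝ)
    rw [← hs, ← hs']
    have e1 := mul_le_mul_of_nonneg_left hmain (mul_nonneg (Real.sqrt_nonneg 2) h0)
    have e2 : √2 * s * (√2 * s * φ) = 2 * (s ^ 2 * φ) := by
      linear_combination (s ^ 2 * φ) * h22
    rw [e2] at e1
    have e3 := mul_le_mul_of_nonneg_right hr (sq_nonneg (s' - s))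
    linarith
  · intro q q'
    rw [← key', ← mul_assoc]
    exact mul_le_mul_of_nonneg_right (hsum q q') (abs_nonneg _)

end

section

/-! ### The fluctuations of the statistic -/

variable {n : ℕ} {X : Fin n → Type*} [∀ i, MeasurableSpace (X i)]

/-- What the analysis uses of the function `ψ` and of the model: `ψ` is continuous, bounded by one
and odd under inversion, and `𝒬` is a separable set of densities. -/
structure IsRegularModel (ψ : ℝ≥0∞ → ℝ) (μ : ∀ i, Measure (X i)) (𝒬 : Set (∀ i, X i → ℝ≥0)) :
    Prop where
  continuous : Continuous ψ
  abs_le_one : ∀ x, |ψ x| ≤ 1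
  map_inv : ∀ x, ψ x⁻¹ = -ψ x
  isDensity : ∀ q ∈ 𝒬, IsDensity μ q
  separable : IsSeparableModel 𝒬

section Fluctuation

variable {ψ : ℝ≥0∞ → ℝ} {μ : ∀ i, Measure (X i)} [∀ i, SigmaFinite (μ i)]
  {𝒬 : Set (∀ i, X i → ℝ≥0)} {P : ∀ i, Measure (X i)} [∀ i, IsProbabilityMeasure (P i)]
  {pbar q : ∀ i, X i → ℝ≥0} {y : ℝ}

lemma IsRegularModel.bddMeasurable_psiRatio (h : IsRegularModel ψ μ 𝒬) (hp : pbar ∈ 𝒬)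
    (hq : q ∈ 𝒬) (i : Fin n) : BddMeasurable fun x => psiRatio ψ (pbar i x) (q i x) :=
  ⟨measurable_psiRatio h.continuous ((h.isDensity _ hp).measurable i)
    ((h.isDensity _ hq).measurable i), 1, fun _ => h.abs_le_one _⟩

lemma IsRegularModel.bddMeasurable_T (h : IsRegularModel ψ μ 𝒬) (hp : pbar ∈ 𝒬) (hq : q ∈ 𝒬) :
    BddMeasurable fun x => T ψ x pbar q :=
  BddMeasurable.sum _ fun i _ =>
    (h.bddMeasurable_psiRatio hp hq i).comp (measurable_pi_apply i)

lemma IsRegularModel.abs_T_le (h : IsRegularModel ψ μ 𝒬) (x : ∀ i, X i)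
    (q q' : ∀ i, X i → ℝ≥0) : |T ψ x q q'| ≤ n := by
  refine (Finset.abs_sum_le_sum_abs _ _).trans ?_
  refine (Finset.sum_le_sum fun i _ => h.abs_le_one _).trans ?_
  simp

lemma IsRegularModel.integral_T (h : IsRegularModel ψ μ 𝒬) (hp : pbar ∈ 𝒬) (hq : q ∈ 𝒬) :
    ∫ x, T ψ x pbar q ∂(Measure.pi P) = ∑ i, ∫ x, psiRatio ψ (pbar i x) (q i x) ∂(P i) := by
  unfold T
  rw [integral_finsetSum _ fun i _ => ((h.bddMeasurable_psiRatio hp hq i).comp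
    (measurable_pi_apply i)).integrable _]
  exact Finset.sum_congr rfl fun i _ => integral_comp_eval (μ := P)
    (h.bddMeasurable_psiRatio hp hq i).measurable.aestronglyMeasurable

lemma IsRegularModel.abs_integral_T_le (h : IsRegularModel ψ μ 𝒬) (q q' : ∀ i, X i → ℝ≥0) :
    |∫ x, T ψ x q q' ∂(Measure.pi P)| ≤ n := by
  have := norm_integral_le_of_norm_le_const (μ := Measure.pi P) (f := fun x => T ψ x q q')
    (ae_of_all _ fun x => h.abs_T_le x q q')
  simpa using this

lemma IsRegularModel.abs_Z_le (h : IsRegularModel ψ μ 𝒬) (x : ∀ i, X i)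
    (q q' : ∀ i, X i → ℝ≥0) : |Z ψ P x q q'| ≤ 2 * n := by
  have h1 := abs_le.1 (h.abs_T_le x q q')
  have h2 := abs_le.1 (h.abs_integral_T_le (P := P) q q')
  rw [Z, abs_le]
  constructor <;> linarith

lemma IsRegularModel.bddMeasurable_Z (h : IsRegularModel ψ μ 𝒬) (hp : pbar ∈ 𝒬) (hq : q ∈ 𝒬) :
    BddMeasurable fun x => Z ψ P x pbar q :=
  (h.bddMeasurable_T hp hq).sub (.const _)

/-- The process with index set a finite part of the model, to which the concentration inequality
applies. -/
def ratioFamily (ψ : ℝ≥0∞ → ℝ) (P : ∀ i, Measure (X i)) (pbar : ∀ i, X i → ℝ≥0)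
    (s : Finset (∀ i, X i → ℝ≥0)) (q : s) (i : Fin n) (x : X i) : ℝ :=
  psiRatio ψ (pbar i x) (q.1 i x) - ∫ x', psiRatio ψ (pbar i x') (q.1 i x') ∂(P i)

lemma IsRegularModel.isCenteredFamily (h : IsRegularModel ψ μ 𝒬) (hp : pbar ∈ 𝒬)
    {s : Finset (∀ i, X i → ℝ≥0)} (hs : ∀ q ∈ s, q ∈ 𝒬) :
    IsCenteredFamily P (ratioFamily ψ P pbar s) := by
  have hb := fun (q : s) i => h.bddMeasurable_psiRatio hp (hs q.1 q.2) i
  refine ⟨fun q i => (hb q i).measurable.sub measurable_const, fun q i x => ?_, fun q i => ?_⟩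
  · have h1 := abs_le.1 (h.abs_le_one (ratio (q.1 i x) (pbar i x) ^ (1 / 2 : ℝ)))
    have h2 : |∫ x', psiRatio ψ (pbar i x') (q.1 i x') ∂(P i)| ≤ 1 := by
      have := norm_integral_le_of_norm_le_const (μ := P i)
        (f := fun x' => psiRatio ψ (pbar i x') (q.1 i x')) (C := 1)
        (ae_of_all _ fun x => h.abs_le_one _)
      simpa using this
    have h3 := abs_le.1 h2
    unfold ratioFamily psiRatio at *
    rw [abs_le]
    constructor <;> linarith
  · unfold ratioFamily
    rw [integral_sub ((hb q i).integrable _) (integrable_const _)]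
    simp

lemma IsRegularModel.procSum_ratioFamily (h : IsRegularModel ψ μ 𝒬) (hp : pbar ∈ 𝒬)
    {s : Finset (∀ i, X i → ℝ≥0)} (hs : ∀ q ∈ s, q ∈ 𝒬) (q : s) (x : ∀ i, X i) :
    procSum (ratioFamily ψ P pbar s) q x = Z ψ P x pbar q.1 := by
  unfold Z
  rw [h.integral_T hp (hs q.1 q.2)]
  simp only [procSum, ratioFamily, Finset.sum_sub_distrib, T]

lemma IsRegularModel.sum_variance_le (h : IsRegularModel ψ μ 𝒬) {a₀ A a₂ : ℝ}
    (hM : MomentConditions ψ a₀ A a₂ μ 𝒬) (hp : pbar ∈ 𝒬) {s : Finset (∀ i, X i → ℝ≥0)}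
    (hs : ∀ q ∈ s, q ∈ localModel μ 𝒬 P pbar y) (q : s) :
    ∑ i, ∫ x, ratioFamily ψ P pbar s q i x ^ 2 ∂(P i) ≤ a₂ ^ 2 * y ^ 2 := by
  have hq := hs q.1 q.2
  calc ∑ i, ∫ x, ratioFamily ψ P pbar s q i x ^ 2 ∂(P i)
      ≤ ∑ i, a₂ ^ 2 * (hellingerSq (P i) (law μ pbar i) + hellingerSq (P i) (law μ q.1 i)) := by
        refine Finset.sum_le_sum fun i _ => le_trans ?_
          (hM.second_moment_le pbar hp q.1 hq.1 i (P i) inferInstance)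
        have hb := h.bddMeasurable_psiRatio hp hq.1 i
        have hb2 : BddMeasurable fun x => psiRatio ψ (pbar i x) (q.1 i x) ^ 2 := by
          simpa only [sq] using hb.mul hb
        set c := ∫ x', psiRatio ψ (pbar i x') (q.1 i x') ∂(P i) with hc
        have e : ∫ x, ratioFamily ψ P pbar s q i x ^ 2 ∂(P i)
            = ∫ x, psiRatio ψ (pbar i x) (q.1 i x) ^ 2 ∂(P i) - c ^ 2 := by
          have e1 : ∀ x, ratioFamily ψ P pbar s q i x ^ 2
              = psiRatio ψ (pbar i x) (q.1 i x) ^ 2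
                - (2 * c * psiRatio ψ (pbar i x) (q.1 i x) - c ^ 2) := by
            intro x
            simp only [ratioFamily, ← hc]
            ring
          simp only [e1]
          rw [integral_sub (hb2.integrable _) (((hb.const_mul _).sub (.const _)).integrable _),
            integral_sub ((hb.const_mul _).integrable _) (integrable_const _),
            integral_const_mul, ← hc]
          simp
          ring
        rw [e]
        linarith [sq_nonneg c]
    _ = a₂ ^ 2 * (prodHellingerSq P (law μ pbar) + prodHellingerSq P (law μ q.1)) := by
        rw [← Finset.mul_sum, Finset.sum_add_distrib]
        rfl
    _ ≤ a₂ ^ 2 * y ^ 2 := by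
        have := hq.2
        gcongr

/-- Every element of the local model is approximated, for the statistic, by elements of a countable
part of the local model. -/
lemma IsRegularModel.exists_countable_approx (h : IsRegularModel ψ μ 𝒬) (P : ∀ i, Measure (X i))
    [∀ i, IsProbabilityMeasure (P i)] (hp : pbar ∈ 𝒬) (y : ℝ) :
    ∃ S ⊆ localModel μ 𝒬 P pbar y, S.Countable ∧ ∀ q ∈ localModel μ 𝒬 P pbar y,
      ∃ u : ℕ → ∀ i, X i → ℝ≥0, (∀ᶠ k in atTop, u k ∈ S) ∧
        ∀ x, Tendsto (fun k => Z ψ P x pbar (u k)) atTop (𝓝 (Z ψ P x pbar q)) := by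
  obtain ⟨S, hS𝒬, hSc, hS⟩ := h.separable
  refine ⟨S ∩ localModel μ 𝒬 P pbar y, inter_subset_right, hSc.mono inter_subset_left,
    fun q hq => ?_⟩
  obtain ⟨u, huS, hu⟩ := hS q hq.1
  have hu𝒬 : ∀ k, u k ∈ 𝒬 := fun k => hS𝒬 (huS k)
  refine ⟨u, ?_, fun x => ?_⟩
  · have hgap : 0 < y ^ 2
        - (prodHellingerSq P (law μ pbar) + prodHellingerSq P (law μ q)) := sub_pos.2 hq.2
    set ε := (y ^ 2 - (prodHellingerSq P (law μ pbar) + prodHellingerSq P (law μ q)))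
      / (n + 1) with hε
    have hεpos : 0 < ε := by positivity
    have hev : ∀ᶠ k in atTop, ∀ i, hellingerSq (P i) (law μ (u k) i)
        < hellingerSq (P i) (law μ q i) + ε := by
      rw [eventually_all]
      intro i
      exact eventually_hellingerSq_lt ((h.isDensity q hq.1).measurable i)
        ((h.isDensity q hq.1).lintegral_eq_one i)
        (fun k => (h.isDensity _ (hu𝒬 k)).measurable i)
        (fun k => (h.isDensity _ (hu𝒬 k)).lintegral_eq_one i) (fun x => (hu i x).1) hεpos
    filter_upwards [hev] with k hk
    refine ⟨huS k, hu𝒬 k, ?_⟩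
    have h1 : prodHellingerSq P (law μ (u k)) ≤ prodHellingerSq P (law μ q) + n * ε := by
      unfold prodHellingerSq
      refine (Finset.sum_le_sum fun i _ => (hk i).le).trans ?_
      rw [Finset.sum_add_distrib]
      simp
    have h2 : n * ε < (n + 1) * ε := by linarith
    have h3 : (n + 1) * ε
        = y ^ 2 - (prodHellingerSq P (law μ pbar) + prodHellingerSq P (law μ q)) := by
      rw [hε]; field_simp
    show _ < _
    linarith
  · have hT : ∀ x, Tendsto (fun k => T ψ x pbar (u k)) atTop (𝓝 (T ψ x pbar q)) := fun x =>
      tendsto_finsetSum _ fun i _ =>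
        tendsto_psiRatio h.continuous _ (hu i (x i)).1 (hu i (x i)).2
    refine (hT x).sub ?_
    refine tendsto_integral_of_dominated_convergence (fun _ => (n : ℝ))
      (fun k => (h.bddMeasurable_T hp (hu𝒬 k)).measurable.aestronglyMeasurable)
      (integrable_const _) (fun k => ae_of_all _ fun x => h.abs_T_le x _ _)
      (ae_of_all _ hT)

lemma IsRegularModel.bddAbove_abs_Z (h : IsRegularModel ψ μ 𝒬) (x : ∀ i, X i)
    (S : Set (∀ i, X i → ℝ≥0)) : BddAbove (range fun q : S => |Z ψ P x pbar q|) :=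
  ⟨2 * n, by rintro _ ⟨q, rfl⟩; exact h.abs_Z_le x _ _⟩

lemma IsRegularModel.bddMeasurable_iSup_abs_Z (h : IsRegularModel ψ μ 𝒬) (hp : pbar ∈ 𝒬)
    (y : ℝ) : BddMeasurable fun x => ⨆ q : localModel μ 𝒬 P pbar y, |Z ψ P x pbar q| := by
  obtain ⟨S, hSs, hSc, hS⟩ := h.exists_countable_approx P hp y
  have e : (fun x => ⨆ q : localModel μ 𝒬 P pbar y, |Z ψ P x pbar q|)
      = fun x => ⨆ q : S, |Z ψ P x pbar q| := by
    ext x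
    rcases isEmpty_or_nonempty (localModel μ 𝒬 P pbar y) with hE | hE
    · have : IsEmpty S := ⟨fun q => hE.false ⟨q.1, hSs q.2⟩⟩
      simp [Real.iSup_of_isEmpty]
    · refine le_antisymm (ciSup_le fun q => ?_) ?_
      · obtain ⟨u, hu, hlim⟩ := hS q.1 q.2
        refine le_of_tendsto (hlim x).abs ?_
        filter_upwards [hu] with k hk
        exact le_ciSup (h.bddAbove_abs_Z x S) ⟨u k, hk⟩
      · obtain ⟨u, hu, -⟩ := hS _ hE.some.2
        obtain ⟨k, hk⟩ := hu.exists
        have : Nonempty S := ⟨⟨u k, hk⟩⟩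
        exact ciSup_le fun q => le_ciSup (h.bddAbove_abs_Z x (localModel μ 𝒬 P pbar y))
          ⟨q.1, hSs q.2⟩
  constructor
  · rw [e]
    have := hSc.to_subtype
    exact Measurable.iSup fun q =>
      (h.bddMeasurable_Z hp (hSs q.2).1).measurable.abs
  · refine ⟨2 * n, fun x => ?_⟩
    rw [abs_of_nonneg (Real.iSup_nonneg fun q => abs_nonneg _)]
    exact Real.iSup_le (fun q => h.abs_Z_le x _ _) (by positivity)

lemma IsRegularModel.fluctuation_le (h : IsRegularModel ψ μ 𝒬) (pbar : ∀ i, X i → ℝ≥0) (y : ℝ) :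
    fluctuation ψ μ 𝒬 P pbar y ≤ 2 * n := by
  have := norm_integral_le_of_norm_le_const (μ := Measure.pi P)
    (f := fun x => ⨆ q : localModel μ 𝒬 P pbar y, |Z ψ P x pbar q|) (C := 2 * n)
    (ae_of_all _ fun x => by
      rw [Real.norm_of_nonneg (Real.iSup_nonneg fun q => abs_nonneg _)]
      exact Real.iSup_le (fun q => h.abs_Z_le x _ _) (by positivity))
  simp only [probReal_univ, mul_one] at this
  exact (le_abs_self _).trans this

lemma IsRegularModel.integral_procMax_le (h : IsRegularModel ψ μ 𝒬) (hp : pbar ∈ 𝒬)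
    {s : Finset (∀ i, X i → ℝ≥0)} [Nonempty s] (hs : ∀ q ∈ s, q ∈ localModel μ 𝒬 P pbar y) :
    ∫ x, procMax (ratioFamily ψ P pbar s) x ∂(Measure.pi P) ≤ fluctuation ψ μ 𝒬 P pbar y := by
  have hs' : ∀ q ∈ s, q ∈ 𝒬 := fun q hq => (hs q hq).1
  refine integral_mono ((h.isCenteredFamily hp hs').bddMeasurable_procMax.integrable _)
    ((h.bddMeasurable_iSup_abs_Z hp y).integrable _) fun x => ?_
  refine Finset.sup'_le _ _ fun q _ => ?_
  rw [h.procSum_ratioFamily hp hs']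
  exact (le_abs_self _).trans
    (le_ciSup (h.bddAbove_abs_Z x (localModel μ 𝒬 P pbar y)) ⟨q.1, hs q.1 q.2⟩)

/-- The deviations of the statistic over the local model of radius `y`. -/
theorem IsRegularModel.measure_exists_Z_gt_le (h : IsRegularModel ψ μ 𝒬) {a₀ A a₂ : ℝ}
    (hM : MomentConditions ψ a₀ A a₂ μ 𝒬) (hp : pbar ∈ 𝒬) (y t : ℝ) {l : ℝ} (hl : 0 < l)
    (hl4 : l < 1 / 4) :
    Measure.pi P {x | ∃ q ∈ localModel μ 𝒬 P pbar y, t < Z ψ P x pbar q}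
      ≤ ENNReal.ofReal (Real.exp (-l * t + l * (fluctuation ψ μ 𝒬 P pbar y
          + Real.exp (4 * l) * (a₂ ^ 2 * y ^ 2) * l) / (1 - 4 * l))) := by
  classical
  set b := ENNReal.ofReal (Real.exp (-l * t + l * (fluctuation ψ μ 𝒬 P pbar y
          + Real.exp (4 * l) * (a₂ ^ 2 * y ^ 2) * l) / (1 - 4 * l))) with hb
  have h4 : 0 < 1 - 4 * l := by linarith
  have fin : ∀ s : Finset (∀ i, X i → ℝ≥0), (∀ q ∈ s, q ∈ localModel μ 𝒬 P pbar y) →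
      Measure.pi P {x | ∃ q ∈ s, t < Z ψ P x pbar q} ≤ b := by
    intro s hs
    rcases s.eq_empty_or_nonempty with rfl | hne
    · simp
    have : Nonempty s := hne.to_subtype
    have hs' : ∀ q ∈ s, q ∈ 𝒬 := fun q hq => (hs q hq).1
    have h1 := (h.isCenteredFamily (P := P) hp hs').measure_procMax_ge_le
      (h.sum_variance_le hM hp hs) hl hl4 t
    have h2 : {x | ∃ q ∈ s, t < Z ψ P x pbar q}
        ⊆ {x | t ≤ procMax (ratioFamily ψ P pbar s) x} := by
      rintro x ⟨q, hq, hx⟩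
      have h3 := procSum_le_procMax (ratioFamily ψ P pbar s) ⟨q, hq⟩ x
      rw [h.procSum_ratioFamily hp hs'] at h3
      exact hx.le.trans h3
    refine (measure_mono h2).trans ?_
    rw [← ofReal_measureReal]
    refine ENNReal.ofReal_le_ofReal (h1.trans (Real.exp_le_exp.2 ?_))
    have := h.integral_procMax_le (P := P) hp hs
    gcongr
  obtain ⟨S, hSs, hSc, hS⟩ := h.exists_countable_approx P hp y
  rcases S.eq_empty_or_nonempty with rfl | hne
  · have : {x | ∃ q ∈ localModel μ 𝒬 P pbar y, t < Z ψ P x pbar q} = ∅ := by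
      refine eq_empty_of_forall_notMem ?_
      rintro x ⟨q, hq, -⟩
      obtain ⟨u, hu, -⟩ := hS q hq
      obtain ⟨k, hk⟩ := hu.exists
      exact hk
    simp [this]
  obtain ⟨e, he⟩ := hSc.exists_eq_range hne
  have hsub : {x | ∃ q ∈ localModel μ 𝒬 P pbar y, t < Z ψ P x pbar q}
      ⊆ ⋃ k : ℕ, {x | ∃ q ∈ (Finset.range k).image e, t < Z ψ P x pbar q} := by
    rintro x ⟨q, hq, hx⟩
    obtain ⟨u, hu, hlim⟩ := hS q hq
    obtain ⟨k, hk1, hk2⟩ := (hu.and ((hlim x).eventually_const_lt hx)).exists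
    rw [he] at hk1
    obtain ⟨j, hj⟩ := hk1
    exact mem_iUnion.2 ⟨j + 1, u k,
      Finset.mem_image.2 ⟨j, Finset.mem_range.2 (Nat.lt_succ_self j), hj⟩, hk2⟩
  have hmono : Monotone fun k : ℕ =>
      {x | ∃ q ∈ (Finset.range k).image e, t < Z ψ P x pbar q} := by
    rintro k k' hkk x ⟨q, hq, hx⟩
    exact ⟨q, Finset.image_subset_image (Finset.range_mono hkk) hq, hx⟩
  refine (measure_mono hsub).trans ?_
  rw [hmono.measure_iUnion]
  refine iSup_le fun k => fin _ fun q hq => ?_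
  obtain ⟨j, -, rfl⟩ := Finset.mem_image.1 hq
  exact hSs (he ▸ mem_range_self j)

/-! ### The local dimension -/

lemma IsRegularModel.bddAbove_dim (h : IsRegularModel ψ μ 𝒬) {a₁ : ℝ} (ha₁ : 0 < a₁)
    (pbar : ∀ i, X i → ℝ≥0) :
    16 * n / a₁ ∈ upperBounds {z : ℝ | ∃ y : ℝ, 0 < y ∧ z = y ^ 2 ∧
      a₁ * y ^ 2 / 8 < fluctuation ψ μ 𝒬 P pbar y} := by
  rintro z ⟨y, -, rfl, hy⟩
  have := h.fluctuation_le (P := P) pbar y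
  rw [le_div_iff₀ ha₁]
  linarith

lemma IsRegularModel.localDim_mem (h : IsRegularModel ψ μ 𝒬) (hn : 0 < n) {a₁ a₂ : ℝ}
    (ha₁ : 0 < a₁) (ha₂ : a₁ ≤ a₂ ^ 2) (pbar : ∀ i, X i → ℝ≥0) :
    localDim ψ a₁ a₂ μ 𝒬 P pbar ∈ Icc (1 : ℝ) n := by
  refine ⟨le_max_left _ _, max_le (by exact_mod_cast hn) ?_⟩
  have h1 : sSup {z : ℝ | ∃ y : ℝ, 0 < y ∧ z = y ^ 2 ∧
      a₁ * y ^ 2 / 8 < fluctuation ψ μ 𝒬 P pbar y} ≤ 16 * n / a₁ :=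
    Real.sSup_le (fun z hz => h.bddAbove_dim ha₁ pbar hz) (by positivity)
  have h2 : 0 < a₂ ^ 2 := ha₁.trans_le ha₂
  have ha₂0 : a₂ ≠ 0 := by rintro rfl; norm_num at h2
  calc _ ≤ (a₁ / (4 * a₂)) ^ 2 * (16 * n / a₁) := by gcongr
    _ = a₁ / a₂ ^ 2 * n := by field_simp; norm_num
    _ ≤ 1 * n := by
      gcongr
      rwa [div_le_one h2]
    _ = n := one_mul _

/-- Beyond the radius given by the local dimension, the expected fluctuation is small. -/
lemma IsRegularModel.fluctuation_le_of_localDim_lt (h : IsRegularModel ψ μ 𝒬) {a₁ a₂ : ℝ}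
    (ha₁ : 0 < a₁) (hy : 0 < y)
    (hD : localDim ψ a₁ a₂ μ 𝒬 P pbar < (a₁ / (4 * a₂)) ^ 2 * y ^ 2) :
    fluctuation ψ μ 𝒬 P pbar y ≤ a₁ * y ^ 2 / 8 := by
  by_contra hc
  push Not at hc
  have h1 : y ^ 2 ≤ sSup {z : ℝ | ∃ y : ℝ, 0 < y ∧ z = y ^ 2 ∧
      a₁ * y ^ 2 / 8 < fluctuation ψ μ 𝒬 P pbar y} :=
    le_csSup ⟨_, h.bddAbove_dim ha₁ pbar⟩ ⟨y, hy, rfl, hc⟩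
  have h2 := (mul_le_mul_of_nonneg_left h1 (sq_nonneg (a₁ / (4 * a₂)))).trans
    (le_max_right (1 : ℝ) _)
  exact absurd (hD.trans_le h2) (lt_irrefl _)

end Fluctuation

end

section

/-! ### Peeling and the performance of the estimators -/

variable {n : ℕ} {X : Fin n → Type*} [∀ i, MeasurableSpace (X i)]

section Bounds

variable {ψ : ℝ≥0∞ → ℝ} {μ : ∀ i, Measure (X i)} [∀ i, SigmaFinite (μ i)]
  {𝒬 : Set (∀ i, X i → ℝ≥0)} {P : ∀ i, Measure (X i)} [∀ i, IsProbabilityMeasure (P i)]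
  {pbar : ∀ i, X i → ℝ≥0}

lemma prodHellingerSq_nonneg (P Q : ∀ i, Measure (X i)) : 0 ≤ prodHellingerSq P Q :=
  Finset.sum_nonneg fun _ _ => hellingerSq_nonneg _ _

lemma IsDensity.prodHellingerSq_le {q : ∀ i, X i → ℝ≥0} (hq : IsDensity μ q) :
    prodHellingerSq P (law μ q) ≤ n := by
  refine (Finset.sum_le_sum fun i _ =>
    hellingerSq_le_one (R := P i) (hq.measurable i) (hq.lintegral_eq_one i)).trans ?_
  simp

lemma IsRegularModel.integral_T_le (h : IsRegularModel ψ μ 𝒬) {a₀ A a₂ : ℝ}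
    (hM : MomentConditions ψ a₀ A a₂ μ 𝒬) (hp : pbar ∈ 𝒬) {q : ∀ i, X i → ℝ≥0} (hq : q ∈ 𝒬) :
    ∫ x, T ψ x pbar q ∂(Measure.pi P)
      ≤ a₀ * prodHellingerSq P (law μ pbar) - A * prodHellingerSq P (law μ q) := by
  rw [h.integral_T hp hq]
  refine (Finset.sum_le_sum fun i _ =>
    hM.expectation_le pbar hp q hq i (P i) inferInstance).trans (le_of_eq ?_)
  rw [Finset.sum_sub_distrib, ← Finset.mul_sum, ← Finset.mul_sum]
  rfl

lemma exp_four_mul_le {l : ℝ} (hl : l ≤ 1 / 120) : Real.exp (4 * l) ≤ 30 / 29 := by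
  have h1 := Real.add_one_le_exp (-(4 * l))
  have h2 : Real.exp (4 * l) * Real.exp (-(4 * l)) = 1 := by rw [← Real.exp_add]; simp
  have h3 := Real.exp_pos (4 * l)
  nlinarith

/-- The bound on the exponent in the deviation inequality at a level of the peeling.  Here `w` is
the expected fluctuation, `z` the squared radius of the local model, and `l` is chosen as
`a₁ / (20 * a₂ ^ 2)`, which is at most `1 / 120`. -/
lemma exponent_le {a₁ a₂ A m W w z N : ℝ} (ha₁ : 0 < a₁) (ha₂ : 6 * a₁ ≤ a₂ ^ 2)
    (hm : 1 ≤ 4 / 5 * m * (A / (3 * a₁) - 0.183)) (hW : 0 ≤ W) (hN : 0 ≤ N)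
    (hz : z = N * (m * (16 * a₂ ^ 2 / a₁ ^ 2) * W)) (hm0 : 0 ≤ m) (hw : w ≤ a₁ * z / 8) :
    -(a₁ / (20 * a₂ ^ 2)) * (A * z / 3) + a₁ / (20 * a₂ ^ 2)
        * (w + Real.exp (4 * (a₁ / (20 * a₂ ^ 2))) * (a₂ ^ 2 * z) * (a₁ / (20 * a₂ ^ 2)))
        / (1 - 4 * (a₁ / (20 * a₂ ^ 2))) ≤ -(N * W) := by
  have h2 : 0 < a₂ ^ 2 := by linarith
  have ha₂0 : a₂ ≠ 0 := by rintro rfl; norm_num at h2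
  set l := a₁ / (20 * a₂ ^ 2) with hl
  have hl0 : 0 < l := by positivity
  have hl1 : l ≤ 1 / 120 := by
    rw [hl, div_le_iff₀ (by positivity)]
    linarith
  have hz0 : 0 ≤ z := by rw [hz]; positivity
  have e1 : a₂ ^ 2 * l = a₁ / 20 := by rw [hl]; field_simp
  have e2 : l * (a₁ * z) = 4 / 5 * m * (N * W) := by
    rw [hz, hl]; field_simp; ring
  have hexp := exp_four_mul_le hl1
  have h3 : w + Real.exp (4 * l) * (a₂ ^ 2 * z) * l ≤ a₁ * z * (1 / 8 + 30 / 29 / 20) := by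
    have : Real.exp (4 * l) * (a₂ ^ 2 * z) * l ≤ 30 / 29 * (a₁ * z / 20) := by
      rw [show Real.exp (4 * l) * (a₂ ^ 2 * z) * l = Real.exp (4 * l) * (a₂ ^ 2 * l * z) by ring,
        e1, show a₁ / 20 * z = a₁ * z / 20 by ring]
      gcongr
    linarith
  have h4 : (w + Real.exp (4 * l) * (a₂ ^ 2 * z) * l) / (1 - 4 * l) ≤ 0.183 * (a₁ * z) := by
    rw [div_le_iff₀ (by linarith)]
    have : 0 ≤ a₁ * z := by positivity
    nlinarith
  have h5 := mul_le_mul_of_nonneg_left h4 hl0.le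
  have h6 : A * z / 3 = A / (3 * a₁) * (a₁ * z) := by field_simp
  rw [h6, mul_div_assoc]
  have h7 : -l * (A / (3 * a₁) * (a₁ * z)) + l * (0.183 * (a₁ * z))
      = -(4 / 5 * m * (A / (3 * a₁) - 0.183) * (N * W)) := by
    linear_combination (-(A / (3 * a₁)) + 0.183) * e2
  calc -l * (A / (3 * a₁) * (a₁ * z))
        + l * ((w + Real.exp (4 * l) * (a₂ ^ 2 * z) * l) / (1 - 4 * l))
      ≤ -l * (A / (3 * a₁) * (a₁ * z)) + l * (0.183 * (a₁ * z)) := by gcongr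
    _ = -(4 / 5 * m * (A / (3 * a₁) - 0.183) * (N * W)) := h7
    _ ≤ -(1 * (N * W)) := by
      have := mul_le_mul_of_nonneg_right hm (mul_nonneg hN hW)
      linarith
    _ = -(N * W) := by ring

/-- The squared radii of the peeling: a geometric progression whose first term is proportional to
`D + ξ`. -/
def peelSq (a₁ a₂ m W : ℝ) (j : ℕ) : ℝ := 2 ^ j * (m * (16 * a₂ ^ 2 / a₁ ^ 2) * W)

lemma tsum_ofReal_exp_le (ξ : ℝ) :
    ∑' j : ℕ, ENNReal.ofReal (Real.exp (-(ξ + (j + 1)))) ≤ ENNReal.ofReal (Real.exp (-ξ)) := by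
  have hs := hasSum_geometric_two' (Real.exp (-ξ))
  calc ∑' j : ℕ, ENNReal.ofReal (Real.exp (-(ξ + (j + 1))))
      ≤ ∑' j : ℕ, ENNReal.ofReal (Real.exp (-ξ) / 2 / 2 ^ j) := by
        refine ENNReal.tsum_le_tsum fun j => ENNReal.ofReal_le_ofReal ?_
        have h2 : (2 : ℝ) ^ (j + 1) ≤ Real.exp (j + 1) := by
          have h3 : (2 : ℝ) ≤ Real.exp 1 := by linarith [Real.add_one_le_exp (1 : ℝ)]
          calc (2 : ℝ) ^ (j + 1) ≤ Real.exp 1 ^ (j + 1) := by gcongr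
            _ = Real.exp (j + 1) := by rw [← Real.exp_nat_mul]; push_cast; ring_nf
        rw [neg_add, Real.exp_add, Real.exp_neg (j + 1 : ℝ), div_div, ← pow_succ',
          ← div_eq_mul_inv]
        gcongr
    _ = ENNReal.ofReal (Real.exp (-ξ)) := by
        rw [← ENNReal.ofReal_tsum_of_nonneg (fun j => by positivity) hs.summable, hs.tsum_eq]

/-- With large probability the fluctuations are controlled at all levels of the peeling. -/
lemma IsRegularModel.measure_peeling_le (h : IsRegularModel ψ μ 𝒬) {a₀ A a₁ a₂ m : ℝ}
    (hM : MomentConditions ψ a₀ A a₂ μ 𝒬) (ha₁ : 0 < a₁) (ha₂ : 6 * a₁ ≤ a₂ ^ 2) (hm1 : 1 < m)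
    (hm : 1 ≤ 4 / 5 * m * (A / (3 * a₁) - 0.183)) (hp : pbar ∈ 𝒬) {ξ W : ℝ} (hξ : 0 ≤ ξ)
    (hW : W = localDim ψ a₁ a₂ μ 𝒬 P pbar + ξ) :
    Measure.pi P {x | ∃ j : ℕ, ∃ q ∈ localModel μ 𝒬 P pbar √(peelSq a₁ a₂ m W j),
        A * peelSq a₁ a₂ m W j / 3 < Z ψ P x pbar q}
      ≤ ENNReal.ofReal (Real.exp (-ξ)) := by
  have h2 : 0 < a₂ ^ 2 := by linarith
  have ha₂0 : a₂ ≠ 0 := by rintro rfl; norm_num at h2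
  have hD1 : 1 ≤ localDim ψ a₁ a₂ μ 𝒬 P pbar := le_max_left _ _
  have hW1 : 1 + ξ ≤ W := by linarith
  have hW0 : 0 < W := by linarith
  have hpos : ∀ j, 0 < peelSq a₁ a₂ m W j := fun j => by unfold peelSq; positivity
  set l := a₁ / (20 * a₂ ^ 2) with hl
  have hl0 : 0 < l := by positivity
  have hl1 : l ≤ 1 / 120 := by
    rw [hl, div_le_iff₀ (by positivity)]
    linarith
  rw [ofPred_exists]
  refine (measure_iUnion_le _).trans (le_trans (ENNReal.tsum_le_tsum fun j => ?_)
    (tsum_ofReal_exp_le ξ))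
  refine (h.measure_exists_Z_gt_le hM hp _ _ hl0 (by linarith)).trans
    (ENNReal.ofReal_le_ofReal (Real.exp_le_exp.2 ?_))
  have hj : (1 : ℝ) ≤ 2 ^ j := one_le_pow₀ (by norm_num)
  have hfl : fluctuation ψ μ 𝒬 P pbar √(peelSq a₁ a₂ m W j) ≤ a₁ * peelSq a₁ a₂ m W j / 8 := by
    have := h.fluctuation_le_of_localDim_lt (P := P) (pbar := pbar) (a₁ := a₁) (a₂ := a₂)
      (y := √(peelSq a₁ a₂ m W j)) ha₁ (Real.sqrt_pos.2 (hpos j)) ?_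
    · rwa [Real.sq_sqrt (hpos j).le] at this
    · rw [Real.sq_sqrt (hpos j).le]
      have e : (a₁ / (4 * a₂)) ^ 2 * peelSq a₁ a₂ m W j = 2 ^ j * (m * W) := by
        unfold peelSq; field_simp; norm_num
      rw [e]
      have h3 : W < m * W := by nlinarith
      have h4 : m * W ≤ 2 ^ j * (m * W) := le_mul_of_one_le_left (by positivity) hj
      linarith
  rw [Real.sq_sqrt (hpos j).le]
  refine (exponent_le ha₁ ha₂ hm hW0.le (by positivity) rfl (by linarith) hfl).trans ?_
  have h5 : (j : ℝ) + 1 ≤ 2 ^ j := by exact_mod_cast Nat.lt_two_pow_self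
  have h6 : (2 : ℝ) ^ j * (1 + ξ) ≤ 2 ^ j * W := by gcongr
  nlinarith

/-- On the event of the peeling, the minimality of the estimator and the first moment condition
bound its loss. -/
lemma IsRegularModel.loss_le (h : IsRegularModel ψ μ 𝒬) {a₀ A a₁ a₂ m : ℝ}
    (hM : MomentConditions ψ a₀ A a₂ μ 𝒬) (ha₀ : 0 ≤ a₀) (hA : 0 < A) (ha₁ : 0 < a₁)
    (ha₂ : 0 < a₂ ^ 2) (hm : 0 < m) (hp : pbar ∈ 𝒬) {W : ℝ} (hW : 0 < W)
    {phat : (∀ i, X i) → ∀ i, X i → ℝ≥0} (hphat : IsRhoEstimator ψ 𝒬 phat) {x : ∀ i, X i}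
    (hx : ∀ j : ℕ, ∀ q ∈ localModel μ 𝒬 P pbar √(peelSq a₁ a₂ m W j),
      Z ψ P x pbar q ≤ A * peelSq a₁ a₂ m W j / 3) :
    prodHellingerSq P (law μ (phat x))
      ≤ 6 * (a₀ / A + 1) * prodHellingerSq P (law μ pbar)
        + m * (16 * a₂ ^ 2 / a₁ ^ 2) * W := by
  have ha₂0 : a₂ ≠ 0 := by rintro rfl; norm_num at ha₂
  set H := prodHellingerSq P (law μ pbar) with hH
  have hH0 : 0 ≤ H := prodHellingerSq_nonneg _ _
  set z₀ := m * (16 * a₂ ^ 2 / a₁ ^ 2) * W with hz₀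
  have hz₀0 : 0 < z₀ := by positivity
  have hz : ∀ j, peelSq a₁ a₂ m W j = 2 ^ j * z₀ := fun j => rfl
  have hpos : ∀ j, 0 < peelSq a₁ a₂ m W j := fun j => by rw [hz]; positivity
  -- the control of the fluctuations, according to the level of the peeling
  have hZ : ∀ q ∈ 𝒬, (H + prodHellingerSq P (law μ q) < z₀ → Z ψ P x pbar q ≤ A * z₀ / 3) ∧
      (z₀ ≤ H + prodHellingerSq P (law μ q) →
        Z ψ P x pbar q ≤ 2 / 3 * A * (H + prodHellingerSq P (law μ q))) := by
    intro q hq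
    constructor
    · intro hs
      have h0 := hx 0 q ⟨hq, by rw [Real.sq_sqrt (hpos 0).le, hz]; simpa using hs⟩
      rw [hz] at h0
      simpa using h0
    · intro hs
      set s := H + prodHellingerSq P (law μ q)
      obtain ⟨j, hj1, hj2⟩ := exists_nat_pow_near (x := s / z₀) (y := (2 : ℝ))
        (by rwa [one_le_div hz₀0]) (by norm_num)
      rw [le_div_iff₀ hz₀0] at hj1
      rw [div_lt_iff₀ hz₀0] at hj2
      have h0 := hx (j + 1) q ⟨hq, by rw [Real.sq_sqrt (hpos _).le, hz]; exact hj2⟩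
      rw [hz, pow_succ] at h0
      nlinarith
  have hT : ∀ q ∈ 𝒬, T ψ x pbar q
      ≤ a₀ * H - A * prodHellingerSq P (law μ q) + Z ψ P x pbar q := by
    intro q hq
    have h1 := h.integral_T_le (P := P) hM hp hq
    unfold Z
    linarith
  have hsup : (⨆ q' : 𝒬, T ψ x pbar q') ≤ (a₀ + A) * H + A * z₀ / 3 := by
    have : Nonempty 𝒬 := ⟨⟨pbar, hp⟩⟩
    refine ciSup_le fun q => ?_
    have h1 := hT q.1 q.2
    have h2 := hZ q.1 q.2
    have h3 := prodHellingerSq_nonneg P (law μ q.1)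
    have h4 : 0 ≤ A * H := by positivity
    have h5 : 0 ≤ A * prodHellingerSq P (law μ q.1) := by positivity
    have h6 : 0 ≤ A * z₀ := by positivity
    rcases lt_or_ge (H + prodHellingerSq P (law μ q.1)) z₀ with hs | hs
    · linarith [h2.1 hs]
    · linarith [h2.2 hs]
  obtain ⟨hq, hmin⟩ := hphat x
  have hbdd : BddAbove (range fun q' : 𝒬 => T ψ x (phat x) q') :=
    ⟨n, by rintro _ ⟨q, rfl⟩; exact (abs_le.1 (h.abs_T_le x _ _)).2⟩
  have hswap : T ψ x (phat x) pbar = -T ψ x pbar (phat x) := by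
    unfold T
    rw [← Finset.sum_neg_distrib]
    exact Finset.sum_congr rfl fun i _ => psiRatio_swap h.map_inv _ _
  have hlow : -((a₀ + A) * H + A * z₀ / 3) ≤ T ψ x pbar (phat x) := by
    have h1 := le_ciSup hbdd ⟨pbar, hp⟩
    simp only [hswap] at h1
    linarith [h1.trans ((hmin pbar hp).trans hsup)]
  have hup := hT _ hq
  have h2 := hZ _ hq
  set K := prodHellingerSq P (law μ (phat x))
  have hr : 0 ≤ 6 * (a₀ / A + 1) * H := by positivity
  rcases lt_or_ge (H + K) z₀ with hs | hs
  · linarith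
  · have h3 := h2.2 hs
    have h4 : A * (H + K) ≤ A * (6 * (a₀ / A + 1) * H + z₀) := by
      have e : A * (6 * (a₀ / A + 1) * H + z₀) = 6 * (a₀ + A) * H + A * z₀ := by field_simp
      rw [e]
      linarith
    have h5 := le_of_mul_le_mul_left h4 hA
    linarith

/-- Integration of an exponential tail. -/
lemma integral_le_add_one_of_tail {Ω : Type*} [MeasurableSpace Ω] {Q : Measure Ω}
    [IsProbabilityMeasure Q] {f : Ω → ℝ} (hf : Integrable f Q) (b : ℝ)
    (h : ∀ ξ : ℝ, 0 ≤ ξ → Q {x | ¬ (f x ≤ b + ξ)} ≤ ENNReal.ofReal (Real.exp (-ξ))) :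
    ∫ x, f x ∂Q ≤ b + 1 := by
  have hg : Integrable (fun x => max (f x - b) 0) Q := (hf.sub (integrable_const b)).pos_part
  have h1 : ENNReal.ofReal (∫ x, max (f x - b) 0 ∂Q) ≤ 1 := by
    rw [ofReal_integral_eq_lintegral_ofReal hg (ae_of_all _ fun x => le_max_right _ _),
      lintegral_eq_lintegral_meas_lt (f := fun x => max (f x - b) 0) Q (ae_of_all _ fun x => le_max_right _ _) hg.aemeasurable]
    calc ∫⁻ t in Ioi 0, Q {x | t < max (f x - b) 0}
        ≤ ∫⁻ t in Ioi 0, ENNReal.ofReal (Real.exp (-t)) := by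
          refine setLIntegral_mono' measurableSet_Ioi fun t ht => ?_
          refine le_trans (measure_mono fun x hx => ?_) (h t (le_of_lt ht))
          have ht' : (0 : ℝ) < t := ht
          rcases lt_max_iff.1 (show t < max (f x - b) 0 from hx) with hx | hx
          · simp only [mem_ofPred_eq, not_le]
            linarith
          · linarith
      _ = 1 := by
          rw [← ofReal_integral_eq_lintegral_ofReal (integrableOn_exp_neg_Ioi 0)
            (ae_of_all _ fun t => (Real.exp_pos _).le), integral_exp_neg_Ioi_zero,
            ENNReal.ofReal_one]
  have h2 : ∫ x, max (f x - b) 0 ∂Q ≤ 1 := by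
    rwa [← ENNReal.ofReal_one, ENNReal.ofReal_le_ofReal_iff zero_le_one] at h1
  have h3 : ∫ x, (f x - b) ∂Q ≤ ∫ x, max (f x - b) 0 ∂Q :=
    integral_mono (hf.sub (integrable_const b)) hg fun x => le_max_left _ _
  rw [integral_sub hf (integrable_const b)] at h3
  simp at h3
  linarith

/-- The performance bounds when the first moment condition holds with a constant `A` that may be
larger than the constant `a₁` in the definition of the local dimension. -/
theorem IsRegularModel.rhoBounds (h : IsRegularModel ψ μ 𝒬) (hn : 0 < n) {a₀ A a₁ a₂ m C : ℝ}
    (hM : MomentConditions ψ a₀ A a₂ μ 𝒬) (ha₀ : 0 ≤ a₀) (hA : 0 < A) (ha₁ : 0 < a₁)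
    (ha₂ : 6 * a₁ ≤ a₂ ^ 2) (hm1 : 1 < m) (hm : 1 ≤ 4 / 5 * m * (A / (3 * a₁) - 0.183))
    (hC1 : 6 * (a₀ / A + 1) ≤ C) (hC2 : m * (16 * a₂ ^ 2 / a₁ ^ 2) ≤ C) :
    RhoBounds C ψ a₁ a₂ μ 𝒬 P := by
  have h2 : 0 < a₂ ^ 2 := by linarith
  have hC0 : 0 < C := by
    have : 0 < 6 * (a₀ / A + 1) := by positivity
    linarith
  have hdim : ∀ pbar, localDim ψ a₁ a₂ μ 𝒬 P pbar ∈ Icc (1 : ℝ) n :=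
    fun pbar => h.localDim_mem hn ha₁ (by linarith) pbar
  have hdev : ∀ phat, IsRhoEstimator ψ 𝒬 phat → ∀ pbar ∈ 𝒬, ∀ ξ : ℝ, 0 ≤ ξ →
      Measure.pi P {x | ¬ (prodHellingerSq P (law μ (phat x))
        ≤ C * (prodHellingerSq P (law μ pbar) + localDim ψ a₁ a₂ μ 𝒬 P pbar + ξ))}
      ≤ ENNReal.ofReal (Real.exp (-ξ)) := by
    intro phat hphat pbar hp ξ hξ
    refine le_trans (measure_mono fun x hx => ?_)
      (h.measure_peeling_le (P := P) hM ha₁ ha₂ hm1 hm hp hξ rfl)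
    by_contra hc
    simp only [mem_ofPred_eq, not_exists, not_and, not_lt] at hc
    have hW : 0 < localDim ψ a₁ a₂ μ 𝒬 P pbar + ξ := by linarith [(hdim pbar).1]
    refine hx ((h.loss_le hM ha₀ hA ha₁ h2 (by linarith) hp hW hphat hc).trans ?_)
    rw [add_assoc, mul_add C]
    exact add_le_add (mul_le_mul_of_nonneg_right hC1 (prodHellingerSq_nonneg P (law μ pbar)))
      (mul_le_mul_of_nonneg_right hC2 hW.le)
  refine ⟨fun pbar _ => hdim pbar, hdev, fun phat hphat hmeas => ?_⟩
  have hint : Integrable (fun x => prodHellingerSq P (law μ (phat x))) (Measure.pi P) :=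
    Integrable.of_bound hmeas.aestronglyMeasurable n (ae_of_all _ fun x => by
      rw [Real.norm_of_nonneg (prodHellingerSq_nonneg _ _)]
      exact (h.isDensity _ (hphat x).1).prodHellingerSq_le)
  have hrisk : ∀ pbar ∈ 𝒬, ∫ x, prodHellingerSq P (law μ (phat x)) ∂(Measure.pi P)
      ≤ C * (prodHellingerSq P (law μ pbar) + localDim ψ a₁ a₂ μ 𝒬 P pbar + 1) := by
    intro pbar hp
    have h3 := integral_le_add_one_of_tail (hint.div_const C)
      (prodHellingerSq P (law μ pbar) + localDim ψ a₁ a₂ μ 𝒬 P pbar) fun ξ hξ => by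
        simp only [div_le_iff₀' hC0]
        exact hdev phat hphat pbar hp ξ hξ
    rwa [integral_div, div_le_iff₀' hC0] at h3
  have hne : Nonempty 𝒬 := by
    have : Nonempty (∀ i, X i) := (Measure.pi P).nonempty_of_neZero
    exact ⟨⟨_, (hphat (Classical.arbitrary _)).1⟩⟩
  refine ⟨hint, ?_, ?_⟩
  · rw [← div_le_iff₀' hC0]
    exact le_ciInf fun pbar => (div_le_iff₀' hC0).2 (hrisk pbar.1 pbar.2)
  · rw [← div_le_iff₀' hC0]
    refine le_ciInf fun pbar => (div_le_iff₀' hC0).2 ((hrisk pbar.1 pbar.2).trans ?_)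
    exact mul_le_mul_of_nonneg_left (by linarith [(hdim pbar.1).1]) hC0.le

end Bounds

/-- The general `ψ`; the constant `C` depends on `a₀`, `a₁`, `a₂` only. -/
lemma rhoBounds_general (hn : 0 < n) {a₀ a₁ a₂ : ℝ} (ha₀ : 1 ≤ a₀) (ha₁ : 0 < a₁)
    (ha₂ : max 1 (6 * a₁) ≤ a₂ ^ 2) (μ : ∀ i, Measure (X i)) [∀ i, SigmaFinite (μ i)]
    (𝒬 : Set (∀ i, X i → ℝ≥0)) (h𝒬 : ∀ q ∈ 𝒬, IsDensity μ q) (hsep : IsSeparableModel 𝒬)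
    {ψ : ℝ≥0∞ → ℝ} (hψ : IsRhoFunction ψ) (hM : MomentConditions ψ a₀ a₁ a₂ μ 𝒬)
    (P : ∀ i, Measure (X i)) [∀ i, IsProbabilityMeasure (P i)] :
    RhoBounds (max (6 * (a₀ / a₁ + 1)) (9 * (16 * a₂ ^ 2 / a₁ ^ 2))) ψ a₁ a₂ μ 𝒬 P := by
  have htop : ψ ∞ = 1 := by
    have := hψ.map_inv 0
    rw [hψ.map_zero, ENNReal.inv_zero] at this
    linarith
  have hreg : IsRegularModel ψ μ 𝒬 := by
    refine ⟨hψ.continuous, fun x => abs_le.2 ⟨?_, ?_⟩, hψ.map_inv, h𝒬, hsep⟩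
    · rw [← hψ.map_zero]
      exact hψ.strictMono.monotone bot_le
    · rw [← htop]
      exact hψ.strictMono.monotone le_top
  refine hreg.rhoBounds hn hM (m := 9) (by linarith) ha₁ ha₁ ((le_max_right _ _).trans ha₂)
    (by norm_num) ?_ (le_max_left _ _) (le_max_right _ _)
  have : a₁ / (3 * a₁) = 1 / 3 := by field_simp
  rw [this]
  norm_num

lemma rhoBounds_psi₁ (hn : 0 < n) (μ : ∀ i, Measure (X i)) [∀ i, SigmaFinite (μ i)]
    (𝒬 : Set (∀ i, X i → ℝ≥0)) (h𝒬 : ∀ q ∈ 𝒬, IsDensity μ q) (hsep : IsSeparableModel 𝒬)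
    (P : ∀ i, Measure (X i)) [∀ i, IsProbabilityMeasure (P i)] :
    RhoBounds 26350 psi₁ (3 / 8) √(3 * √2) μ 𝒬 P := by
  have hreg : IsRegularModel psi₁ μ 𝒬 :=
    ⟨continuous_psi₁, abs_psi₁_le, psi₁_inv, h𝒬, hsep⟩
  have h1 : (1.4 : ℝ) ≤ √2 := Real.le_sqrt_of_sq_le (by norm_num)
  have h2 : √2 ≤ (1.5 : ℝ) := Real.sqrt_le_iff.2 (by norm_num)
  have h3 : √(3 * √2) ^ 2 = 3 * √2 := Real.sq_sqrt (by positivity)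
  refine hreg.rhoBounds hn (momentConditions_psi₁ μ 𝒬 h𝒬) (m := 9) (by norm_num) (by norm_num)
    (by norm_num) ?_ (by norm_num) (by norm_num) (by norm_num) ?_
  · rw [h3]; linarith
  · rw [h3]; norm_num; linarith

/-- For `psi₂` the first moment condition holds with the constant `3 / 8`, more than four times the
constant `0.083` of the local dimension; this leaves the room that the constant `26350` needs. -/
lemma rhoBounds_psi₂ (hn : 0 < n) (μ : ∀ i, Measure (X i)) [∀ i, SigmaFinite (μ i)]
    (𝒬 : Set (∀ i, X i → ℝ≥0)) (h𝒬 : ∀ q ∈ 𝒬, IsDensity μ q) (hsep : IsSeparableModel 𝒬)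
    (P : ∀ i, Measure (X i)) [∀ i, IsProbabilityMeasure (P i)] :
    RhoBounds 26350 psi₂ 0.083 √(3 + 2 * √2) μ 𝒬 P := by
  have hreg : IsRegularModel psi₂ μ 𝒬 :=
    ⟨continuous_psi₂, abs_psi₂_le, psi₂_inv, h𝒬, hsep⟩
  have h1 : (1.4 : ℝ) ≤ √2 := Real.le_sqrt_of_sq_le (by norm_num)
  have h2 : √2 ≤ (1.415 : ℝ) := Real.sqrt_le_iff.2 (by norm_num)
  have h3 : √(3 + 2 * √2) ^ 2 = 3 + 2 * √2 := Real.sq_sqrt (by positivity)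
  refine hreg.rhoBounds hn (momentConditions_psi₂ μ 𝒬 h𝒬) (m := 1.9) (by norm_num) (by norm_num)
    (by norm_num) ?_ (by norm_num) (by norm_num) (by norm_num) ?_
  · rw [h3]; linarith
  · rw [h3, ← mul_div_assoc, div_le_iff₀ (by norm_num)]; linarith

end

end

end RhoEst

theorem mainTheorem1 :
    -- for the functions `ψ₁` and `ψ₂`: the universal constant `26350`
    (∀ (n : ℕ) (_ : 0 < n) (X : Fin n → Type*) [∀ i, MeasurableSpace (X i)]
        (μ : ∀ i, Measure (X i)) [∀ i, SigmaFinite (μ i)] (𝒬 : Set (∀ i, X i → ℝ≥0))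
        (_ : ∀ q ∈ 𝒬, RhoEst.IsDensity μ q) (_ : RhoEst.IsSeparableModel 𝒬)
        (P : ∀ i, Measure (X i)) [∀ i, IsProbabilityMeasure (P i)],
        RhoEst.RhoBounds 26350 RhoEst.psi₁ (3 / 8) √(3 * √2) μ 𝒬 P ∧
        RhoEst.RhoBounds 26350 RhoEst.psi₂ 0.083 √(3 + 2 * √2) μ 𝒬 P) ∧
    -- for a general `ψ`: a constant depending only on `a₀`, `a₁`, `a₂`
    (∀ a₀ a₁ a₂ : ℝ, 1 ≤ a₀ → 0 < a₁ → a₁ ≤ 1 → 0 ≤ a₂ → max 1 (6 * a₁) ≤ a₂ ^ 2 →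
      ∃ C : ℝ, 1 ≤ C ∧
        ∀ (n : ℕ) (_ : 0 < n) (X : Fin n → Type*) [∀ i, MeasurableSpace (X i)]
          (μ : ∀ i, Measure (X i)) [∀ i, SigmaFinite (μ i)] (𝒬 : Set (∀ i, X i → ℝ≥0))
          (_ : ∀ q ∈ 𝒬, RhoEst.IsDensity μ q) (_ : RhoEst.IsSeparableModel 𝒬)
          (ψ : ℝ≥0∞ → ℝ) (_ : RhoEst.IsRhoFunction ψ)
          (_ : RhoEst.MomentConditions ψ a₀ a₁ a₂ μ 𝒬)
          (P : ∀ i, Measure (X i)) [∀ i, IsProbabilityMeasure (P i)],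
          RhoEst.RhoBounds C ψ a₁ a₂ μ 𝒬 P) := by
  refine ⟨fun n hn X _ μ _ 𝒬 h𝒬 hsep P _ => ⟨RhoEst.rhoBounds_psi₁ hn μ 𝒬 h𝒬 hsep P,
    RhoEst.rhoBounds_psi₂ hn μ 𝒬 h𝒬 hsep P⟩, fun a₀ a₁ a₂ ha₀ ha₁ _ _ ha₂ =>
    ⟨max (6 * (a₀ / a₁ + 1)) (9 * (16 * a₂ ^ 2 / a₁ ^ 2)), le_max_of_le_left ?_,
      fun n hn X _ μ _ 𝒬 h𝒬 hsep ψ hψ hM P _ =>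
        RhoEst.rhoBounds_general hn ha₀ ha₁ ha₂ μ 𝒬 h𝒬 hsep hψ hM P⟩⟩
  have : 0 ≤ a₀ / a₁ := by positivity
  linarith
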